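/- For a sequence $\bar p=(p(1),p(2),\dots)$ with $0\le p(i)\le 1$, let $G(n,\bar p)$ be the random graph with vertex set $[n]=\{1,\dots,n\}$ in which each pair of distinct vertices $v,w$ is joined by an edge with probability $p(|v-w|)$, independently for all pairs. Let $L$ be the first-order language (with equality) whose only non-logical symbol is the binary adjacency relation, and for a sentence $\psi$ of $L$ let $\mathrm{Prob}(n,\bar p;\psi)$ be the probability that $G(n,\bar p)$ satisfies $\psi$. **Theorem 1.** (i) Let $\bar p$ be a sequence with $0\le p(i)<1$ for all $i\ge 1$ and $$\frac{\log\left(\prod_{i=1}^n(1-p(i))\right)}{\log n}\longrightarrow 0\qquad(n\to\infty).$$ Then a zero-one law holds for every sentence $\psi$ of $L$: as $n\to\infty$, $\mathrm{Prob}(n,\bar p;\psi)$ converges to $0$ or converges to $1$. (ii) For every $\varepsilon>0$ there exist a sequence $\bar p$ with $0\le p(i)<1$ for all $i\ge 1$ and a sentence $\psi$ of $L$ such that $$-\frac{\log\left(\prod_{i=1}^n(1-p(i))\right)}{\log n}<\varepsilon\qquad\text{for all } n\ge 2,$$ but $\liminf_{n\to\infty}\mathrm{Prob}(n,\bar p;\psi)=0$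 while $\limsup_{n\to\infty}\mathrm{Prob}(n,\bar p;\psi)=1$. -/

import Mathlib

open Filter Topology

namespace DistanceRandomGraph

open Classical in
/-- The probability that the random graph `G(n, p)` is equal to `G`. The vertices are the `n`
points of `Fin n` in their natural order, and a pair `v < w` is an edge with probability
`p (w - v)`, independently for all pairs. (The value `p 0` is never used.) -/
noncomputable def graphProb (p : ℕ → ℝ) (n : ℕ) (G : SimpleGraph (Fin n)) : ℝ :=
  ∏ e : Fin n × Fin n with e.1 < e.2,
    if G.Adj e.1 e.2 then p ((e.2 : ℕ) - (e.1 : ℕ)) else 1 - p ((e.2 : ℕ) - (e.1 : ℕ))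

/-- The graph `G`, as a structure whose only relation is adjacency, satisfies the first-order
sentence `ψ`. -/
def Satisfies {V : Type} (G : SimpleGraph V) (ψ : FirstOrder.Language.graph.Sentence) : Prop :=
  @FirstOrder.Language.Sentence.Realize FirstOrder.Language.graph V G.structure ψ

open Classical in
/-- The probability that `G(n, p)` satisfies the first-order sentence `ψ` of the language of
graphs. -/
noncomputable def sentenceProb (p : ℕ → ℝ) (n : ℕ) (ψ : FirstOrder.Language.graph.Sentence) : ℝ :=
  ∑ G : SimpleGraph (Fin n) with Satisfies G ψ, graphProb p n G

end DistanceRandomGraph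

/-!
**The zero-one law.** Let `S n = -log ∏_{i ≤ n} (1 - p i)` (`totalLoad`). A sentence of quantifier
depth `k` cannot distinguish graphs for which the duplicator wins the `k`-round
Ehrenfeucht–Fraïssé game (`RoundEquiv.satisfies_iff`), and there are only finitely many classes of
this equivalence. Uniting `k` disjoint copies of a representative of every class that can occur
gives a finite graph `F` that occurs with positive probability and absorbs all possible outcomes:
`G ⊕ F` is equivalent to `F` (`exists_absorbing`). Since removing edges from a possible outcome
leaves a possible outcome, every possible outcome that has an isolated copy of `F` on an interval
is equivalent to `F` (`IsolatedAt.roundEquiv`). So it suffices that isolated copies of `F` occur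
with probability tending to `1`. At a given position the probability is at least a constant times
`exp (-2 f S n)`, with `f` the number of vertices of `F`, and this is `n ^ (-o(1))` if
`S n = o(log n)`. The copies at two positions are correlated only by the pairs that join the two
intervals, and the total correlation of one interval with all others is `O(S n)`
(`sum_sum_load_inter_le`). Hence Chebyshev's inequality applies
(`exists_eventProb_no_isolated_le`).

**The counterexample.** Distance `1` gets a small positive probability, and the distances in blocks
of length `L` that start at `2 ^ (r * L)`, for `L = (k + 1)!`, get probability `1 / 2`
(`blockProb`). If `r ≥ 4 / ε`, then `S n < ε log n`. The sentence states that there is a path on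
`r + 1` vertices without edges to other vertices. For `n = 2 ^ L`, before the block of length `L`,
the load `S n` is that of the much shorter earlier blocks, and isolated paths occur by the bound
above. For `n = 4 * 2 ^ (r * L)` each vertex has at least `L` pairs with distance in the block, so
a given set of `r + 1` vertices has no edges to other vertices with probability
`O(2 ^ (-(r + 1) * L))`, while there are only `O(L ^ r * 2 ^ (r * L))` possible paths
(`sentenceProb_closedPath_le`).
-/

namespace DistanceRandomGraph

/-! ### Ehrenfeucht–Fraïssé games on graphs -/

/-- `BackForth G H k R`: the duplicator wins the Ehrenfeucht–Fraïssé game with `k` rounds left on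
`G` and `H`, when the pairs of vertices chosen so far are the elements of `R`. The position is a
set of pairs (possibly infinite) and not a pair of tuples, so that positions of games on the
components of a disjoint sum can be united. -/
def BackForth {V W : Type} (G : SimpleGraph V) (H : SimpleGraph W) : ℕ → Set (V × W) → Prop
  | 0, R => ∀ a ∈ R, ∀ b ∈ R, (a.1 = b.1 ↔ a.2 = b.2) ∧ (G.Adj a.1 b.1 ↔ H.Adj a.2 b.2)
  | k + 1, R => (∀ x, ∃ y, BackForth G H k (insert (x, y) R)) ∧
      ∀ y, ∃ x, BackForth G H k (insert (x, y) R)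

section BackForth

variable {U V W X : Type} {F : SimpleGraph U} {G : SimpleGraph V} {H : SimpleGraph W}
  {K : SimpleGraph X}

lemma BackForth.mono {k : ℕ} {R S : Set (V × W)} (h : BackForth G H k R) (hS : S ⊆ R) :
    BackForth G H k S := by
  induction k generalizing R S with
  | zero => exact fun a ha b hb => h a (hS ha) b (hS hb)
  | succ k ih =>
    refine ⟨fun x => ?_, fun y => ?_⟩
    · obtain ⟨y, hy⟩ := h.1 x
      exact ⟨y, ih hy (Set.insert_subset_insert hS)⟩
    · obtain ⟨x, hx⟩ := h.2 y
      exact ⟨x, ih hx (Set.insert_subset_insert hS)⟩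

lemma BackForth.zero {k : ℕ} {R : Set (V × W)} (h : BackForth G H k R) : BackForth G H 0 R := by
  induction k generalizing R with
  | zero => exact h
  | succ k ih =>
    intro a ha
    obtain ⟨y, hy⟩ := h.1 a.1
    exact (ih hy).mono (Set.subset_insert _ _) a ha

lemma BackForth.pred {k : ℕ} {R : Set (V × W)} (h : BackForth G H (k + 1) R) :
    BackForth G H k R := by
  induction k generalizing R with
  | zero => exact h.zero
  | succ k ih =>
    refine ⟨fun x => ?_, fun y => ?_⟩
    · obtain ⟨y, hy⟩ := h.1 x
      exact ⟨y, ih hy⟩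
    · obtain ⟨x, hx⟩ := h.2 y
      exact ⟨x, ih hx⟩

lemma BackForth.symm {k : ℕ} {R : Set (V × W)} (h : BackForth G H k R) :
    BackForth H G k (Prod.swap ⁻¹' R) := by
  induction k generalizing R with
  | zero =>
    intro a ha b hb
    have := h a.swap ha b.swap hb
    exact ⟨this.1.symm, this.2.symm⟩
  | succ k ih =>
    refine ⟨fun y => ?_, fun x => ?_⟩
    · obtain ⟨x, hx⟩ := h.2 y
      refine ⟨x, (ih hx).mono ?_⟩
      rintro ⟨a, b⟩ (h | h)
      · left; simp_all
      · right; exact h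
    · obtain ⟨y, hy⟩ := h.1 x
      refine ⟨y, (ih hy).mono ?_⟩
      rintro ⟨a, b⟩ (h | h)
      · left; simp_all
      · right; exact h

lemma BackForth.trans {k : ℕ} {R : Set (U × V)} {S : Set (V × W)} {T : Set (U × W)}
    (hR : BackForth F G k R) (hS : BackForth G H k S)
    (hT : ∀ a ∈ T, ∃ y, (a.1, y) ∈ R ∧ (y, a.2) ∈ S) : BackForth F H k T := by
  induction k generalizing R S T with
  | zero =>
    intro a ha b hb
    obtain ⟨y, hy, hy'⟩ := hT a ha
    obtain ⟨z, hz, hz'⟩ := hT b hb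
    have h1 := hR _ hy _ hz
    have h2 := hS _ hy' _ hz'
    exact ⟨h1.1.trans h2.1, h1.2.trans h2.2⟩
  | succ k ih =>
    have key : ∀ x y z, BackForth F G k (insert (x, y) R) → BackForth G H k (insert (y, z) S) →
        BackForth F H k (insert (x, z) T) := by
      intro x y z h1 h2
      refine ih h1 h2 ?_
      rintro a (rfl | ha)
      · exact ⟨y, .inl rfl, .inl rfl⟩
      · obtain ⟨w, hw, hw'⟩ := hT a ha
        exact ⟨w, .inr hw, .inr hw'⟩
    refine ⟨fun x => ?_, fun z => ?_⟩
    · obtain ⟨y, hy⟩ := hR.1 x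
      obtain ⟨z, hz⟩ := hS.1 y
      exact ⟨z, key x y z hy hz⟩
    · obtain ⟨y, hy⟩ := hS.2 z
      obtain ⟨x, hx⟩ := hR.2 y
      exact ⟨x, key x y z hx hy⟩

lemma BackForth.of_iso (e : G ≃g H) {k : ℕ} {R : Set (V × W)} (hR : ∀ a ∈ R, a.2 = e a.1) :
    BackForth G H k R := by
  induction k generalizing R with
  | zero =>
    intro a ha b hb
    rw [hR a ha, hR b hb]
    exact ⟨e.injective.eq_iff.symm, e.map_rel_iff.symm⟩
  | succ k ih =>
    refine ⟨fun x => ⟨e x, ih ?_⟩, fun y => ⟨e.symm y, ih ?_⟩⟩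
    · rintro a (rfl | ha)
      · rfl
      · exact hR a ha
    · rintro a (rfl | ha)
      · simp
      · exact hR a ha

lemma BackForth.sum {k : ℕ} {R : Set (U × V)} {S : Set (W × X)} {T : Set ((U ⊕ W) × (V ⊕ X))}
    (hR : BackForth F G k R) (hS : BackForth H K k S)
    (hT : T ⊆ Prod.map Sum.inl Sum.inl '' R ∪ Prod.map Sum.inr Sum.inr '' S) :
    BackForth (F ⊕g H) (G ⊕g K) k T := by
  induction k generalizing R S T with
  | zero =>
    intro a ha b hb
    rcases hT ha with ⟨c, hc, rfl⟩ | ⟨c, hc, rfl⟩ <;>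
    rcases hT hb with ⟨d, hd, rfl⟩ | ⟨d, hd, rfl⟩
    · simpa using hR c hc d hd
    · simp
    · simp
    · simpa using hS c hc d hd
  | succ k ih =>
    have left : ∀ x y, BackForth F G k (insert (x, y) R) →
        BackForth (F ⊕g H) (G ⊕g K) k (insert (Sum.inl x, Sum.inl y) T) := by
      intro x y h
      refine ih h hS.pred ?_
      rintro a (rfl | ha)
      · exact .inl ⟨(x, y), .inl rfl, rfl⟩
      · exact (hT ha).imp_left fun h => Set.image_mono (Set.subset_insert _ _) h
    have right : ∀ x y, BackForth H K k (insert (x, y) S) →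
        BackForth (F ⊕g H) (G ⊕g K) k (insert (Sum.inr x, Sum.inr y) T) := by
      intro x y h
      refine ih hR.pred h ?_
      rintro a (rfl | ha)
      · exact .inr ⟨(x, y), .inl rfl, rfl⟩
      · exact (hT ha).imp_right fun h => Set.image_mono (Set.subset_insert _ _) h
    constructor
    · rintro (x | x)
      · exact (hR.1 x).elim fun y hy => ⟨_, left x y hy⟩
      · exact (hS.1 x).elim fun y hy => ⟨_, right x y hy⟩
    · rintro (y | y)
      · exact (hR.2 y).elim fun x hx => ⟨_, left x y hx⟩
      · exact (hS.2 y).elim fun x hx => ⟨_, right x y hx⟩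

/-- The disjoint union of copies of `G` indexed by `ι`. -/
def copies (ι : Type) (G : SimpleGraph V) : SimpleGraph (ι × V) where
  Adj a b := a.1 = b.1 ∧ G.Adj a.2 b.2
  symm := ⟨fun _ _ h => ⟨h.1.symm, h.2.symm⟩⟩
  loopless := ⟨fun _ h => G.irrefl h.2⟩

/-- The duplicator matches copies with copies: `ρ` is the current partial bijection between the
two index types, and a vertex played in a copy is answered by the same vertex of the matched copy,
a fresh copy being matched when needed. -/
lemma BackForth.copies_of_card {ι κ : Type} [Fintype ι] [Fintype κ] {k : ℕ} (ρ : Finset (ι × κ))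
    (hρ : ∀ a ∈ ρ, ∀ b ∈ ρ, a.1 = b.1 ↔ a.2 = b.2) (hι : ρ.card + k ≤ Fintype.card ι)
    (hκ : ρ.card + k ≤ Fintype.card κ) :
    BackForth (copies ι G) (copies κ G) k {a | (a.1.1, a.2.1) ∈ ρ ∧ a.1.2 = a.2.2} := by
  classical
  induction k generalizing ρ with
  | zero =>
    rintro ⟨⟨i, x⟩, ⟨i', x'⟩⟩ ⟨ha, rfl : x = x'⟩ ⟨⟨j, y⟩, ⟨j', y'⟩⟩ ⟨hb, rfl : y = y'⟩
    have := hρ _ ha _ hb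
    simp only [copies, Prod.mk.injEq] at this ⊢
    tauto
  | succ k ih =>
    have match_new : ∀ i j, (∀ j, (i, j) ∉ ρ) → (∀ i, (i, j) ∉ ρ) → ∀ x,
        BackForth (copies ι G) (copies κ G) k
          (insert ((i, x), (j, x)) {a | (a.1.1, a.2.1) ∈ ρ ∧ a.1.2 = a.2.2}) := by
      intro i j hi hj x
      have hc := Finset.card_insert_of_notMem (hi j)
      refine (ih (insert (i, j) ρ) ?_ (by omega) (by omega)).mono ?_
      · rintro ⟨a, a'⟩ ha ⟨b, b'⟩ hb
        simp only [Finset.mem_insert, Prod.mk.injEq] at ha hb ⊢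
        rcases ha with ⟨rfl, rfl⟩ | ha <;> rcases hb with ⟨rfl, rfl⟩ | hb
        · simp
        · exact ⟨fun h => (hi b' (h ▸ hb)).elim, fun h => (hj b (h ▸ hb)).elim⟩
        · exact ⟨fun h => (hi a' (h ▸ ha)).elim, fun h => (hj a (h ▸ ha)).elim⟩
        · exact hρ _ ha _ hb
      · rintro a (rfl | ha)
        · exact ⟨Finset.mem_insert_self _ _, rfl⟩
        · exact ⟨Finset.mem_insert_of_mem ha.1, ha.2⟩
    have match_old : ∀ i j, (i, j) ∈ ρ → ∀ x, BackForth (copies ι G) (copies κ G) k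
        (insert ((i, x), (j, x)) {a | (a.1.1, a.2.1) ∈ ρ ∧ a.1.2 = a.2.2}) := by
      intro i j hij x
      refine (ih ρ hρ (by omega) (by omega)).mono ?_
      rintro a (rfl | ha)
      · exact ⟨hij, rfl⟩
      · exact ha
    constructor
    · rintro ⟨i, x⟩
      by_cases hi : ∃ j, (i, j) ∈ ρ
      · exact hi.elim fun j hj => ⟨_, match_old i j hj x⟩
      · have hlt : (ρ.image Prod.snd).card < Fintype.card κ :=
          Finset.card_image_le.trans_lt (by omega)
        obtain ⟨j, -, hj⟩ := Finset.exists_mem_notMem_of_card_lt_card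
          (hlt.trans_eq Finset.card_univ.symm)
        push Not at hi
        exact ⟨_, match_new i j hi (fun i h => hj (Finset.mem_image_of_mem Prod.snd h)) x⟩
    · rintro ⟨j, x⟩
      by_cases hj : ∃ i, (i, j) ∈ ρ
      · exact hj.elim fun i hi => ⟨_, match_old i j hi x⟩
      · have hlt : (ρ.image Prod.fst).card < Fintype.card ι :=
          Finset.card_image_le.trans_lt (by omega)
        obtain ⟨i, -, hi⟩ := Finset.exists_mem_notMem_of_card_lt_card
          (hlt.trans_eq Finset.card_univ.symm)
        push Not at hj
        exact ⟨_, match_new i j (fun j h => hi (Finset.mem_image_of_mem Prod.fst h)) hj x⟩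

/-! ### Equivalence up to a number of rounds -/

/-- `G` and `H` agree on first-order sentences of quantifier depth at most `k`, in the form of a
winning strategy for the duplicator in the `k`-round game. -/
def RoundEquiv (k : ℕ) (G : SimpleGraph V) (H : SimpleGraph W) : Prop := BackForth G H k ∅

lemma RoundEquiv.of_iso {k : ℕ} (e : G ≃g H) : RoundEquiv k G H := BackForth.of_iso e (by simp)

lemma RoundEquiv.refl {k : ℕ} (G : SimpleGraph V) : RoundEquiv k G G := .of_iso .refl

lemma RoundEquiv.symm {k : ℕ} (h : RoundEquiv k G H) : RoundEquiv k H G := BackForth.symm h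

lemma RoundEquiv.trans {k : ℕ} (h : RoundEquiv k F G) (h' : RoundEquiv k G H) :
    RoundEquiv k F H := BackForth.trans h h' (by simp)

lemma RoundEquiv.sum {k : ℕ} (h : RoundEquiv k F G) (h' : RoundEquiv k H K) :
    RoundEquiv k (F ⊕g H) (G ⊕g K) := BackForth.sum h h' (by simp)

/-- One more copy of `G` is not noticed in `k` rounds next to `k` copies. -/
lemma roundEquiv_sum_copies (k : ℕ) (G : SimpleGraph V) :
    RoundEquiv k (G ⊕g copies (Fin k) G) (copies (Fin k) G) := by
  let e : G ⊕g copies (Fin k) G ≃g copies (Option (Fin k)) G :=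
    { toFun := Sum.elim (fun x => (none, x)) (fun a => (some a.1, a.2))
      invFun := fun a => a.1.elim (Sum.inl a.2) (fun i => Sum.inr (i, a.2))
      left_inv := by rintro (x | ⟨i, x⟩) <;> rfl
      right_inv := by rintro ⟨_ | i, x⟩ <;> rfl
      map_rel_iff' := by rintro (x | ⟨i, x⟩) (y | ⟨j, y⟩) <;> simp [copies] }
  refine (RoundEquiv.of_iso e).trans ?_
  exact (BackForth.copies_of_card ∅ (by simp) (by simp) (by simp)).mono (by simp)

end BackForth

/-! ### First-order sentences and finitely many types -/

open FirstOrder Language in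
/-- The quantifier depth of a formula. -/
def quantifierDepth {L : Language} {α : Type} : {n : ℕ} → L.BoundedFormula α n → ℕ
  | _, .falsum => 0
  | _, .equal _ _ => 0
  | _, .rel _ _ => 0
  | _, .imp f g => max (quantifierDepth f) (quantifierDepth g)
  | _, .all f => quantifierDepth f + 1

section Sentences

variable {V W : Type} {G : SimpleGraph V} {H : SimpleGraph W}

open FirstOrder Language in
lemma BackForth.realize_iff {n : ℕ} (φ : Language.graph.BoundedFormula Empty n) {k : ℕ}
    (hk : quantifierDepth φ ≤ k) {R : Set (V × W)} (h : BackForth G H k R) (v : Empty → V)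
    (w : Empty → W) (xs : Fin n → V) (ys : Fin n → W) (hR : ∀ i, (xs i, ys i) ∈ R) :
    letI := G.structure
    letI := H.structure
    φ.Realize v xs ↔ φ.Realize w ys := by
  let := G.structure
  let := H.structure
  have term : ∀ {n : ℕ} (t : Language.graph.Term (Empty ⊕ Fin n)), ∃ i, t = .var (.inr i) := by
    rintro n ((e | i) | f)
    · exact e.elim
    · exact ⟨i, rfl⟩
    · exact isEmptyElim f
  induction φ generalizing k R with
  | falsum => exact Iff.rfl
  | equal s t =>
    obtain ⟨i, rfl⟩ := term s
    obtain ⟨j, rfl⟩ := term t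
    exact (h.zero _ (hR i) _ (hR j)).1
  | rel r ts =>
    cases r with
    | adj =>
      obtain ⟨i, hi⟩ := term (ts 0)
      obtain ⟨j, hj⟩ := term (ts 1)
      simp only [BoundedFormula.Realize, Structure.RelMap, hi, hj]
      exact (h.zero _ (hR i) _ (hR j)).2
  | imp f g ihf ihg =>
    simp only [quantifierDepth, max_le_iff] at hk
    exact imp_congr (ihf hk.1 h xs ys hR) (ihg hk.2 h xs ys hR)
  | all f ih =>
    obtain ⟨k, rfl⟩ : ∃ m, k = m + 1 := ⟨k - 1, by simp only [quantifierDepth] at hk; omega⟩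
    simp only [quantifierDepth, add_le_add_iff_right] at hk
    have step : ∀ x y, BackForth G H k (insert (x, y) R) →
        (f.Realize v (Fin.snoc xs x) ↔ f.Realize w (Fin.snoc ys y)) := by
      intro x y hxy
      refine ih hk hxy _ _ fun i => ?_
      induction i using Fin.lastCases with
      | last => simp
      | cast i => simpa using Or.inr (hR i)
    constructor
    · intro hf y
      obtain ⟨x, hx⟩ := h.2 y
      exact (step x y hx).1 (hf x)
    · intro hf x
      obtain ⟨y, hy⟩ := h.1 x
      exact (step x y hy).2 (hf y)

lemma RoundEquiv.satisfies_iff (ψ : FirstOrder.Language.graph.Sentence)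
    (h : RoundEquiv (quantifierDepth ψ) G H) : Satisfies G ψ ↔ Satisfies H ψ :=
  BackForth.realize_iff ψ le_rfl h _ _ _ _ (fun i => i.elim0)

/-- The type of `k`-round types of `m`-tuples. -/
def GameType : ℕ → ℕ → Type
  | 0, m => Fin m → Fin m → Prop × Prop
  | k + 1, m => Set (GameType k (m + 1))

instance finite_gameType (k m : ℕ) : Finite (GameType k m) := by
  induction k generalizing m with
  | zero => unfold GameType; infer_instance
  | succ k ih =>
    have := ih (m + 1)
    unfold GameType
    infer_instance

/-- The `k`-round type of a tuple: its equality and adjacency pattern for `k = 0`, and then the set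
of `k`-round types of its extensions by one vertex. -/
def gameType (G : SimpleGraph V) : (k m : ℕ) → (Fin m → V) → GameType k m
  | 0, _, a => fun i j => (a i = a j, G.Adj (a i) (a j))
  | k + 1, m, a => Set.range fun x => gameType G k (m + 1) (Fin.snoc a x)

lemma BackForth.of_gameType_eq {k m : ℕ} (a : Fin m → V) (b : Fin m → W)
    (h : gameType G k m a = gameType H k m b) :
    BackForth G H k (Set.range fun i => (a i, b i)) := by
  induction k generalizing m with
  | zero =>
    rintro _ ⟨i, rfl⟩ _ ⟨j, rfl⟩
    have := congrFun (congrFun h i) j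
    simp only [gameType, Prod.mk.injEq, eq_iff_iff] at this
    exact this
  | succ k ih =>
    have step : ∀ x y, gameType G k (m + 1) (Fin.snoc a x) = gameType H k (m + 1) (Fin.snoc b y) →
        BackForth G H k (insert (x, y) (Set.range fun i => (a i, b i))) := by
      intro x y hxy
      refine (ih _ _ hxy).mono ?_
      rintro _ (rfl | ⟨i, rfl⟩)
      · exact ⟨Fin.last m, by simp⟩
      · exact ⟨i.castSucc, by simp⟩
    have hset : Set.range (fun x => gameType G k (m + 1) (Fin.snoc a x)) =
      Set.range fun y => gameType H k (m + 1) (Fin.snoc b y) := h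
    constructor
    · intro x
      obtain ⟨y, hy⟩ := hset ▸
        Set.mem_range_self (f := fun x => gameType G k (m + 1) (Fin.snoc a x)) x
      exact ⟨y, step x y hy.symm⟩
    · intro y
      obtain ⟨x, hx⟩ := hset.symm ▸
        Set.mem_range_self (f := fun y => gameType H k (m + 1) (Fin.snoc b y)) y
      exact ⟨x, step x y hx⟩

lemma RoundEquiv.of_gameType_eq {k : ℕ}
    (h : gameType G k 0 Fin.elim0 = gameType H k 0 Fin.elim0) : RoundEquiv k G H :=
  (BackForth.of_gameType_eq _ _ h).mono (Set.empty_subset _)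

end Sentences

/-! ### Possible outcomes of the random graph -/

/-- `G` uses only distances of non-zero probability. If no `p i` is equal to `1`, these are exactly
the graphs that are values of `G(n, p)` with positive probability; removing edges keeps the
property. -/
def Supported (p : ℕ → ℝ) {n : ℕ} (G : SimpleGraph (Fin n)) : Prop :=
  ∀ v w : Fin n, v < w → G.Adj v w → p ((w : ℕ) - (v : ℕ)) ≠ 0

lemma Supported.bot (p : ℕ → ℝ) (n : ℕ) : Supported p (⊥ : SimpleGraph (Fin n)) :=
  fun _ _ _ h => h.elim

lemma Supported.exists_sum {p : ℕ → ℝ} {m n : ℕ} {G : SimpleGraph (Fin m)}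
    {H : SimpleGraph (Fin n)} (hG : Supported p G) (hH : Supported p H) :
    ∃ K : SimpleGraph (Fin (m + n)), Supported p K ∧ Nonempty (K ≃g G ⊕g H) := by
  refine ⟨(G ⊕g H).comap finSumFinEquiv.symm, ?_, ⟨.comap finSumFinEquiv.symm _⟩⟩
  intro v w hvw hadj
  obtain ⟨v, rfl⟩ := finSumFinEquiv.surjective v
  obtain ⟨w, rfl⟩ := finSumFinEquiv.surjective w
  rw [SimpleGraph.comap_adj, Equiv.symm_apply_apply, Equiv.symm_apply_apply] at hadj
  rw [Fin.lt_def] at hvw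
  rcases v with v | v <;> rcases w with w | w <;>
    simp only [finSumFinEquiv_apply_left, finSumFinEquiv_apply_right, Fin.val_castAdd,
      Fin.val_natAdd, add_lt_add_iff_left, Nat.add_sub_add_left] at hvw ⊢
  · exact hG v w hvw (by simpa using hadj)
  · simp at hadj
  · simp at hadj
  · exact hH v w hvw (by simpa using hadj)

lemma Supported.exists_copies {p : ℕ → ℝ} {n : ℕ} {G : SimpleGraph (Fin n)}
    (hG : Supported p G) (k : ℕ) :
    ∃ K : SimpleGraph (Fin (k * n)), Supported p K ∧ Nonempty (K ≃g copies (Fin k) G) := by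
  refine ⟨(copies (Fin k) G).comap finProdFinEquiv.symm, ?_, ⟨.comap finProdFinEquiv.symm _⟩⟩
  intro v w hvw hadj
  obtain ⟨⟨i, x⟩, rfl⟩ := finProdFinEquiv.surjective v
  obtain ⟨⟨j, y⟩, rfl⟩ := finProdFinEquiv.surjective w
  simp only [SimpleGraph.comap_adj, Equiv.symm_apply_apply, copies] at hadj
  obtain ⟨rfl, hadj⟩ := hadj
  rw [Fin.lt_def] at hvw
  simp only [finProdFinEquiv_apply_val, add_lt_add_iff_right, Fin.val_fin_lt,
    Nat.add_sub_add_right] at hvw ⊢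
  exact hG x y hvw hadj

/-- A possible outcome that absorbs all possible outcomes: take, for each of the finitely many
`k`-round types of possible outcomes, `k` copies of a graph of this type. -/
lemma exists_absorbing (p : ℕ → ℝ) (k : ℕ) :
    ∃ (f : ℕ) (F : SimpleGraph (Fin f)), Supported p F ∧
      ∀ (n : ℕ) (G : SimpleGraph (Fin n)), Supported p G → RoundEquiv k (G ⊕g F) F := by
  classical
  have := Fintype.ofFinite (GameType k 0)
  suffices h : ∀ T : Finset (GameType k 0), ∃ (f : ℕ) (F : SimpleGraph (Fin f)), Supported p F ∧
      ∀ (n : ℕ) (G : SimpleGraph (Fin n)), Supported p G →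
        gameType G k 0 Fin.elim0 ∈ T → RoundEquiv k (G ⊕g F) F by
    obtain ⟨f, F, hF, h⟩ := h Finset.univ
    exact ⟨f, F, hF, fun n G hG => h n G hG (Finset.mem_univ _)⟩
  intro T
  induction T using Finset.induction with
  | empty => exact ⟨0, ⊥, .bot p 0, by simp⟩
  | insert τ T _ ih =>
    obtain ⟨f, F, hF, hT⟩ := ih
    by_cases hτ : ∃ (m : ℕ) (H : SimpleGraph (Fin m)),
        Supported p H ∧ gameType H k 0 Fin.elim0 = τ
    · obtain ⟨m, H, hH, rfl⟩ := hτ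
      obtain ⟨C, hC, ⟨eC⟩⟩ := hH.exists_copies k
      obtain ⟨K, hK, ⟨eK⟩⟩ := hC.exists_sum hF
      refine ⟨_, K, hK, fun n G hG hmem => ?_⟩
      have e : RoundEquiv k (G ⊕g K) (G ⊕g (C ⊕g F)) := (RoundEquiv.refl G).sum (.of_iso eK)
      refine (e.trans ?_).trans (.of_iso eK.symm)
      rw [Finset.mem_insert] at hmem
      rcases hmem with hmem | hmem
      · have h1 : RoundEquiv k (G ⊕g C) C :=
          ((RoundEquiv.of_gameType_eq hmem).sum (.of_iso eC)).trans
            ((roundEquiv_sum_copies k H).trans (.of_iso eC.symm))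
        exact (RoundEquiv.of_iso SimpleGraph.Iso.sumAssoc.symm).trans (h1.sum (.refl F))
      · have h1 : RoundEquiv k (C ⊕g (G ⊕g F)) (C ⊕g F) := (RoundEquiv.refl C).sum (hT n G hG hmem)
        refine RoundEquiv.trans (.of_iso ?_) h1
        exact SimpleGraph.Iso.sumAssoc.symm.trans
          ((SimpleGraph.Iso.sumCongr SimpleGraph.Iso.sumComm .refl).trans SimpleGraph.Iso.sumAssoc)
    · refine ⟨f, F, hF, fun n G hG hmem => hT n G hG ?_⟩
      rw [Finset.mem_insert] at hmem
      exact hmem.resolve_left fun h => hτ ⟨n, G, hG, h⟩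

/-! ### Isolated copies on intervals -/

/-- The pair `(v, w)` is an edge of the copy of `F` on the interval `s, …, s + f - 1`. -/
def BlockEdge {f : ℕ} (F : SimpleGraph (Fin f)) (s v w : ℕ) : Prop :=
  ∃ a b : Fin f, F.Adj a b ∧ v = s + a ∧ w = s + b

/-- Among the pairs that meet the interval `s, …, s + f - 1`, exactly the edges of the translate of
`F` by `s` are edges of `G`. -/
def IsolatedAt {f n : ℕ} (F : SimpleGraph (Fin f)) (s : ℕ) (G : SimpleGraph (Fin n)) : Prop :=
  ∀ v w : Fin n, v < w → ((v : ℕ) ∈ Finset.Ico s (s + f) ∨ (w : ℕ) ∈ Finset.Ico s (s + f)) →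
    (G.Adj v w ↔ BlockEdge F s v w)

lemma IsolatedAt.adj_iff {f n : ℕ} {F : SimpleGraph (Fin f)} {s : ℕ} {G : SimpleGraph (Fin n)}
    (h : IsolatedAt F s G) (hs : s + f ≤ n) (a : Fin f) (v : Fin n) :
    G.Adj ⟨s + a, by omega⟩ v ↔ ∃ b : Fin f, (v : ℕ) = s + b ∧ F.Adj a b := by
  have ha : s + (a : ℕ) ∈ Finset.Ico s (s + f) := by simp
  rcases lt_trichotomy (⟨s + a, by omega⟩ : Fin n) v with hlt | rfl | hlt
  · rw [h _ _ hlt (.inl ha)]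
    constructor
    · rintro ⟨a', b, hab, h1, h2⟩
      obtain rfl : a = a' := Fin.ext (by simpa using h1)
      exact ⟨b, h2, hab⟩
    · rintro ⟨b, h2, hab⟩
      exact ⟨a, b, hab, rfl, h2⟩
  · simp only [SimpleGraph.irrefl, false_iff, not_exists, not_and]
    intro b hb
    obtain rfl : a = b := Fin.ext (by simpa using hb)
    exact F.irrefl
  · rw [G.adj_comm, h _ _ hlt (.inr ha)]
    constructor
    · rintro ⟨b, a', hab, h2, h1⟩
      obtain rfl : a = a' := Fin.ext (by simpa using h1)
      exact ⟨b, h2, hab.symm⟩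
    · rintro ⟨b, h2, hab⟩
      exact ⟨b, a, hab.symm, h2, rfl⟩

/-- A graph splits along an embedded union of connected components. -/
lemma nonempty_iso_sum {V W : Type} {G : SimpleGraph V} {H : SimpleGraph W} (e : W → V)
    (he : Function.Injective e) (h : ∀ a v, G.Adj (e a) v ↔ ∃ b, v = e b ∧ H.Adj a b) :
    Nonempty (G.induce (Set.range e)ᶜ ⊕g H ≃g G) := by
  have hadj : ∀ a b, G.Adj (e a) (e b) ↔ H.Adj a b := fun a b => by
    rw [h]
    exact ⟨fun ⟨c, hc, hac⟩ => he hc ▸ hac, fun hab => ⟨b, rfl, hab⟩⟩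
  have hout : ∀ a (v : ((Set.range e)ᶜ : Set V)), ¬ G.Adj (e a) v := fun a v hav => by
    obtain ⟨b, hb, -⟩ := (h a v).1 hav
    exact v.2 ⟨b, hb.symm⟩
  refine ⟨⟨Equiv.ofBijective (Sum.elim Subtype.val e) ⟨?_, ?_⟩, ?_⟩⟩
  · refine Function.Injective.sumElim Subtype.val_injective he fun v a hva => v.2 ⟨a, hva.symm⟩
  · intro v
    by_cases hv : v ∈ Set.range e
    · obtain ⟨a, rfl⟩ := hv
      exact ⟨.inr a, rfl⟩
    · exact ⟨.inl ⟨v, hv⟩, rfl⟩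
  · rintro (v | a) (w | b)
    · exact Iff.rfl
    · exact iff_of_false (fun h' => hout b v h'.symm) (by simp)
    · exact iff_of_false (hout a w) (by simp)
    · exact hadj a b

/-- The theory of a possible outcome `G` that contains an isolated copy of the absorbing graph `F`
is that of `F`. If `R` is the rest of `G`, then `G ≅ R ⊕ F`, and `F` absorbs `f` isolated vertices,
which complete `R` to the possible outcome obtained from `G` by deleting the edges of the copy. -/
lemma IsolatedAt.roundEquiv {p : ℕ → ℝ} {k f n s : ℕ} {F : SimpleGraph (Fin f)}
    (hF : ∀ (n : ℕ) (G : SimpleGraph (Fin n)), Supported p G → RoundEquiv k (G ⊕g F) F)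
    {G : SimpleGraph (Fin n)} (hG : Supported p G) (hs : s + f ≤ n) (h : IsolatedAt F s G) :
    RoundEquiv k G F := by
  let e : Fin f → Fin n := fun a => ⟨s + a, by omega⟩
  have he : Function.Injective e := fun a b hab => Fin.ext (by simpa [e] using hab)
  obtain ⟨e₁⟩ := nonempty_iso_sum (G := G) (H := F) e he fun a v => by
    rw [h.adj_iff hs]
    exact exists_congr fun b => and_congr_left' (Fin.ext_iff (a := v) (b := e b)).symm
  let G₀ : SimpleGraph (Fin n) :=
    { Adj := fun v w => G.Adj v w ∧ v ∉ Set.range e ∧ w ∉ Set.range e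
      symm := ⟨fun _ _ h => ⟨h.1.symm, h.2.2, h.2.1⟩⟩
      loopless := ⟨fun _ h => G.irrefl h.1⟩ }
  have hG₀ : Supported p G₀ := fun v w hvw hadj => hG v w hvw hadj.1
  obtain ⟨e₂⟩ := nonempty_iso_sum (G := G₀) (H := (⊥ : SimpleGraph (Fin f))) e he fun a v => by
    simp [G₀]
  have hR : G₀.induce (Set.range e)ᶜ = G.induce (Set.range e)ᶜ := by
    ext ⟨v, hv⟩ ⟨w, hw⟩
    simp only [SimpleGraph.comap_adj, Function.Embedding.subtype_apply, G₀]
    exact and_iff_left ⟨hv, hw⟩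
  rw [hR] at e₂
  have absorb : RoundEquiv k (G.induce (Set.range e)ᶜ ⊕g F)
      (G.induce (Set.range e)ᶜ ⊕g ((⊥ : SimpleGraph (Fin f)) ⊕g F)) :=
    (RoundEquiv.refl _).sum (hF f ⊥ (.bot p f)).symm
  exact (RoundEquiv.of_iso e₁.symm).trans <| absorb.trans <|
    (RoundEquiv.of_iso SimpleGraph.Iso.sumAssoc.symm).trans <|
      ((RoundEquiv.of_iso e₂).sum (.refl F)).trans (hF n G₀ hG₀)

/-! ### Probabilities of events -/

open Classical in
/-- The probability that `G(n, p)` has the property `A`. -/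
noncomputable def eventProb (p : ℕ → ℝ) (n : ℕ) (A : SimpleGraph (Fin n) → Prop) : ℝ :=
  ∑ G : SimpleGraph (Fin n) with A G, graphProb p n G

lemma sentenceProb_eq (p : ℕ → ℝ) (n : ℕ) (ψ : FirstOrder.Language.graph.Sentence) :
    sentenceProb p n ψ = eventProb p n (fun G => Satisfies G ψ) := rfl

open Classical in
/-- The probability that the pair `e` has the status `b` (edge or non-edge). -/
noncomputable def pairProb (p : ℕ → ℝ) {n : ℕ} (e : Fin n × Fin n) (b : Prop) : ℝ :=
  if b then p ((e.2 : ℕ) - (e.1 : ℕ)) else 1 - p ((e.2 : ℕ) - (e.1 : ℕ))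

/-- Probability of a prescribed status of the pairs in `D`. -/
lemma eventProb_cylinder (p : ℕ → ℝ) {n : ℕ} (D : Finset (Fin n × Fin n))
    (hD : ∀ e ∈ D, e.1 < e.2) (b : Fin n × Fin n → Prop) :
    eventProb p n (fun G => ∀ e ∈ D, (G.Adj e.1 e.2 ↔ b e)) = ∏ e ∈ D, pairProb p e (b e) := by
  classical
  let P := {e : Fin n × Fin n // e.1 < e.2}
  let t : P → Finset Prop := fun e => if e.1 ∈ D then {b e.1} else Finset.univ
  let mk : (P → Prop) → SimpleGraph (Fin n) := fun φ =>
    { Adj := fun v w => (∃ h : v < w, φ ⟨(v, w), h⟩) ∨ ∃ h : w < v, φ ⟨(w, v), h⟩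
      symm := ⟨fun _ _ h => h.symm⟩
      loopless := ⟨fun v h => by rcases h with ⟨h, -⟩ | ⟨h, -⟩ <;> exact lt_irrefl _ h⟩ }
  have hmk : ∀ φ (e : P), (mk φ).Adj e.1.1 e.1.2 ↔ φ e := fun φ e =>
    ⟨fun h => h.elim (fun ⟨_, h⟩ => h) (fun ⟨h, _⟩ => (lt_asymm h e.2).elim),
      fun h => .inl ⟨e.2, h⟩⟩
  have hgraph : ∀ G : SimpleGraph (Fin n),
      graphProb p n G = ∏ e : P, pairProb p e.1 (G.Adj e.1.1 e.1.2) := by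
    intro G
    rw [graphProb, ← Finset.prod_subtype (s := Finset.univ.filter fun e : Fin n × Fin n => e.1 < e.2)
      (by simp) (fun e => pairProb p e (G.Adj e.1 e.2))]
    rfl
  have hsum : eventProb p n (fun G => ∀ e ∈ D, (G.Adj e.1 e.2 ↔ b e)) =
      ∑ φ ∈ Fintype.piFinset t, ∏ e : P, pairProb p e.1 (φ e) := by
    rw [eventProb]
    refine Finset.sum_bij' (fun G _ e => G.Adj e.1.1 e.1.2) (fun φ _ => mk φ) ?_ ?_ ?_ ?_ ?_
    · intro G hG
      simp only [Finset.mem_filter, Finset.mem_univ, true_and] at hG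
      rw [Fintype.mem_piFinset]
      intro e
      by_cases he : e.1 ∈ D
      · simpa [t, he] using hG _ he
      · rw [show t e = Finset.univ from if_neg he]
        exact Finset.mem_univ _
    · intro φ hφ
      simp only [Finset.mem_filter, Finset.mem_univ, true_and]
      intro e he
      have := Fintype.mem_piFinset.1 hφ ⟨e, hD e he⟩
      simp only [t, he, if_true, Finset.mem_singleton] at this
      rw [← this]
      exact hmk φ ⟨e, hD e he⟩
    · intro G _
      ext v w
      constructor
      · rintro (⟨_, h⟩ | ⟨_, h⟩)
        · exact h
        · exact h.symm
      · intro h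
        rcases lt_trichotomy v w with hlt | rfl | hlt
        · exact .inl ⟨hlt, h⟩
        · exact (G.irrefl h).elim
        · exact .inr ⟨hlt, h.symm⟩
    · intro φ _
      funext e
      exact propext (hmk φ e)
    · intro G _
      exact hgraph G
  rw [hsum, ← Finset.prod_univ_sum,
    ← Finset.prod_subtype_of_mem (fun e : Fin n × Fin n => pairProb p e (b e)) hD]
  have huniv : ∀ e : Fin n × Fin n, ∑ c : Prop, pairProb p e c = 1 := by
    intro e
    simp [pairProb]
  rw [← Finset.prod_subset (Finset.subset_univ (D.subtype fun e => e.1 < e.2))]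
  · refine Finset.prod_congr rfl fun e he => ?_
    simp [t, Finset.mem_subtype.1 he]
  · intro e _ he
    simp only [Finset.mem_subtype] at he
    simpa [t, he] using huniv e.1

section Probability

variable {p : ℕ → ℝ} {n : ℕ}

lemma pairProb_nonneg (hp : ∀ i : ℕ, 1 ≤ i → 0 ≤ p i ∧ p i < 1) {e : Fin n × Fin n}
    (he : e.1 < e.2) (b : Prop) : 0 ≤ pairProb p e b := by
  have := hp ((e.2 : ℕ) - (e.1 : ℕ)) (by rw [Fin.lt_def] at he; omega)
  unfold pairProb
  split_ifs <;> linarith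

lemma graphProb_nonneg (hp : ∀ i : ℕ, 1 ≤ i → 0 ≤ p i ∧ p i < 1) (G : SimpleGraph (Fin n)) :
    0 ≤ graphProb p n G :=
  Finset.prod_nonneg fun e he => pairProb_nonneg hp (Finset.mem_filter.1 he).2 (G.Adj e.1 e.2)

lemma graphProb_eq_zero {G : SimpleGraph (Fin n)} (hG : ¬ Supported p G) :
    graphProb p n G = 0 := by
  simp only [Supported, not_forall, not_not] at hG
  obtain ⟨v, w, hvw, hadj, h0⟩ := hG
  refine Finset.prod_eq_zero (i := (v, w)) (by simpa using hvw) ?_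
  simp [hadj, h0]

lemma eventProb_nonneg (hp : ∀ i : ℕ, 1 ≤ i → 0 ≤ p i ∧ p i < 1)
    (A : SimpleGraph (Fin n) → Prop) : 0 ≤ eventProb p n A :=
  Finset.sum_nonneg fun G _ => graphProb_nonneg hp G

lemma eventProb_mono (hp : ∀ i : ℕ, 1 ≤ i → 0 ≤ p i ∧ p i < 1)
    {A B : SimpleGraph (Fin n) → Prop} (h : ∀ G, Supported p G → A G → B G) :
    eventProb p n A ≤ eventProb p n B := by
  classical
  simp only [eventProb, Finset.sum_filter]
  refine Finset.sum_le_sum fun G _ => ?_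
  have := graphProb_nonneg hp G
  by_cases hG : Supported p G
  · have := h G hG
    split_ifs <;> tauto
  · simp [graphProb_eq_zero hG]

lemma sum_graphProb (p : ℕ → ℝ) (n : ℕ) : ∑ G : SimpleGraph (Fin n), graphProb p n G = 1 := by
  classical
  have := eventProb_cylinder p (n := n) ∅ (by simp) (fun _ => True)
  simpa [eventProb] using this

lemma eventProb_add_not (p : ℕ → ℝ) (A : SimpleGraph (Fin n) → Prop) :
    eventProb p n A + eventProb p n (fun G => ¬ A G) = 1 := by
  classical
  rw [← sum_graphProb p n]
  simp only [eventProb]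
  convert Finset.sum_filter_add_sum_filter_not Finset.univ A (graphProb p n)

lemma eventProb_le_one (hp : ∀ i : ℕ, 1 ≤ i → 0 ≤ p i ∧ p i < 1)
    (A : SimpleGraph (Fin n) → Prop) : eventProb p n A ≤ 1 := by
  have := eventProb_add_not p A
  have := eventProb_nonneg hp (fun G => ¬ A G)
  linarith

lemma eventProb_exists_le (hp : ∀ i : ℕ, 1 ≤ i → 0 ≤ p i ∧ p i < 1) {ι : Type*} (I : Finset ι)
    (A : ι → SimpleGraph (Fin n) → Prop) :
    eventProb p n (fun G => ∃ i ∈ I, A i G) ≤ ∑ i ∈ I, eventProb p n (A i) := by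
  classical
  simp only [eventProb, Finset.sum_filter]
  rw [Finset.sum_comm]
  refine Finset.sum_le_sum fun G _ => ?_
  have h0 := graphProb_nonneg hp G
  have hnn : ∀ i ∈ I, 0 ≤ if A i G then graphProb p n G else 0 := fun i _ => by
    split_ifs <;> simp [h0]
  split_ifs with h
  · obtain ⟨i, hi, hA⟩ := h
    calc graphProb p n G = if A i G then graphProb p n G else 0 := by rw [if_pos hA]
      _ ≤ _ := Finset.single_le_sum hnn hi
  · exact Finset.sum_nonneg hnn

/-- Chebyshev's inequality for the number of events `A i` that occur. -/
lemma eventProb_none_mul_sq_le (hp : ∀ i : ℕ, 1 ≤ i → 0 ≤ p i ∧ p i < 1) {ι : Type*}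
    (I : Finset ι) (A : ι → SimpleGraph (Fin n) → Prop) :
    eventProb p n (fun G => ∀ i ∈ I, ¬ A i G) * (∑ i ∈ I, eventProb p n (A i)) ^ 2 ≤
      ∑ i ∈ I, ∑ j ∈ I, eventProb p n (fun G => A i G ∧ A j G) -
        (∑ i ∈ I, eventProb p n (A i)) ^ 2 := by
  classical
  set μ := ∑ i ∈ I, eventProb p n (A i) with hμ
  have hE : ∀ B : SimpleGraph (Fin n) → Prop,
      eventProb p n B = ∑ G, graphProb p n G * if B G then 1 else 0 := fun B => by
    simp [eventProb, Finset.sum_filter]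
  let X : SimpleGraph (Fin n) → ℝ := fun G => ∑ i ∈ I, if A i G then 1 else 0
  have h1 : ∑ G, graphProb p n G * X G = μ := by
    simp only [hμ, hE, X, Finset.mul_sum]
    exact Finset.sum_comm
  have h2 : ∑ G, graphProb p n G * X G ^ 2 =
      ∑ i ∈ I, ∑ j ∈ I, eventProb p n (fun G => A i G ∧ A j G) := by
    simp only [hE]
    rw [Finset.sum_congr rfl fun i _ => Finset.sum_comm, Finset.sum_comm]
    refine Finset.sum_congr rfl fun G _ => ?_
    rw [sq, Finset.sum_mul_sum]
    simp only [Finset.mul_sum]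
    refine Finset.sum_congr rfl fun i _ => Finset.sum_congr rfl fun j _ => ?_
    by_cases hi : A i G <;> by_cases hj : A j G <;> simp [hi, hj]
  have h3 : ∑ G, graphProb p n G * (X G - μ) ^ 2 =
      ∑ i ∈ I, ∑ j ∈ I, eventProb p n (fun G => A i G ∧ A j G) - μ ^ 2 := by
    have : ∀ G, graphProb p n G * (X G - μ) ^ 2 = graphProb p n G * X G ^ 2 -
        2 * μ * (graphProb p n G * X G) + μ ^ 2 * graphProb p n G := fun G => by ring
    simp only [this, Finset.sum_add_distrib, Finset.sum_sub_distrib, ← Finset.mul_sum, h1, h2,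
      sum_graphProb]
    ring
  rw [← h3, hE, Finset.sum_mul]
  refine Finset.sum_le_sum fun G _ => ?_
  rw [mul_assoc]
  refine mul_le_mul_of_nonneg_left ?_ (graphProb_nonneg hp G)
  split_ifs with h
  · have : X G = 0 := Finset.sum_eq_zero fun i hi => by simp [h i hi]
    simp [this]
  · simpa using sq_nonneg (X G - μ)

end Probability

/-! ### The load of a sequence of probabilities -/

/-- The cost `-log (1 - p i)` of forbidding an edge of length `i`, set to `0` for the meaningless
length `0`. -/
noncomputable def load (p : ℕ → ℝ) (i : ℕ) : ℝ := if i = 0 then 0 else -Real.log (1 - p i)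

/-- The total cost of forbidding one edge of each length up to `n`. -/
noncomputable def totalLoad (p : ℕ → ℝ) (n : ℕ) : ℝ := ∑ i ∈ Finset.range (n + 1), load p i

section Load

variable {p : ℕ → ℝ} {n : ℕ}

lemma load_nonneg (hp : ∀ i : ℕ, 1 ≤ i → 0 ≤ p i ∧ p i < 1) (i : ℕ) : 0 ≤ load p i := by
  unfold load
  split_ifs with h
  · exact le_rfl
  · have := hp i (by omega)
    have := Real.log_nonpos (x := 1 - p i) (by linarith) (by linarith)
    linarith

lemma totalLoad_nonneg (hp : ∀ i : ℕ, 1 ≤ i → 0 ≤ p i ∧ p i < 1) (n : ℕ) : 0 ≤ totalLoad p n :=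
  Finset.sum_nonneg fun i _ => load_nonneg hp i

lemma exp_neg_load (hp : ∀ i : ℕ, 1 ≤ i → 0 ≤ p i ∧ p i < 1) {i : ℕ} (hi : 1 ≤ i) :
    Real.exp (-load p i) = 1 - p i := by
  have := hp i hi
  rw [load, if_neg (by omega), neg_neg, Real.exp_log (by linarith)]

lemma log_prod_eq (hp : ∀ i : ℕ, 1 ≤ i → 0 ≤ p i ∧ p i < 1) (n : ℕ) :
    Real.log (∏ i ∈ Finset.Icc 1 n, (1 - p i)) = -totalLoad p n := by
  rw [Real.log_prod fun i hi => by have := hp i (Finset.mem_Icc.1 hi).1; linarith, totalLoad,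
    Finset.sum_range_succ', load, if_pos rfl, add_zero, ← Finset.sum_neg_distrib,
    Finset.range_eq_Ico, Finset.sum_Ico_add' (fun i => -load p i) 0 n 1]
  refine Finset.sum_congr (by ext; simp) fun i hi => ?_
  rw [load, if_neg, neg_neg]
  have := (Finset.mem_Ico.1 hi).1
  omega

lemma sum_load_le (hp : ∀ i : ℕ, 1 ≤ i → 0 ≤ p i ∧ p i < 1) {ι : Type*} (T : Finset ι)
    (g : ι → ℕ) (hle : ∀ x ∈ T, g x ≤ n)
    (hinj : ∀ x ∈ T, ∀ y ∈ T, g x = g y → g x ≠ 0 → x = y) :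
    ∑ x ∈ T, load p (g x) ≤ totalLoad p n := by
  classical
  calc ∑ x ∈ T, load p (g x) = ∑ x ∈ T with g x ≠ 0, load p (g x) := by
        rw [Finset.sum_filter]
        refine Finset.sum_congr rfl fun x _ => ?_
        split_ifs with h
        · rfl
        · rw [not_not] at h
          simp [h, load]
    _ = ∑ i ∈ (T.filter fun x => g x ≠ 0).image g, load p i := by
        rw [Finset.sum_image]
        intro x hx y hy hxy
        simp only [Finset.coe_filter, Set.mem_ofPred_eq] at hx hy
        exact hinj x hx.1 y hy.1 hxy hx.2
    _ ≤ totalLoad p n := by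
        refine Finset.sum_le_sum_of_subset_of_nonneg ?_ fun i _ _ => load_nonneg hp i
        intro i hi
        obtain ⟨x, hx, rfl⟩ := Finset.mem_image.1 hi
        have := hle x (Finset.mem_filter.1 hx).1
        simp only [Finset.mem_range]
        omega

lemma prod_one_sub_eq_exp (hp : ∀ i : ℕ, 1 ≤ i → 0 ≤ p i ∧ p i < 1)
    (D : Finset (Fin n × Fin n)) (hD : ∀ e ∈ D, e.1 < e.2) :
    ∏ e ∈ D, (1 - p ((e.2 : ℕ) - (e.1 : ℕ))) =
      Real.exp (-∑ e ∈ D, load p ((e.2 : ℕ) - (e.1 : ℕ))) := by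
  rw [← Finset.sum_neg_distrib, Real.exp_sum]
  refine Finset.prod_congr rfl fun e he => (exp_neg_load hp ?_).symm
  have := Fin.lt_def.1 (hD e he)
  omega

end Load

/-! ### Isolated copies occur with high probability -/

/-- The pairs of vertices that meet the interval `s, …, s + f - 1`. -/
def touching (n f s : ℕ) : Finset (Fin n × Fin n) :=
  {e | e.1 < e.2 ∧ ((e.1 : ℕ) ∈ Finset.Ico s (s + f) ∨ (e.2 : ℕ) ∈ Finset.Ico s (s + f))}

lemma mem_touching {n f s : ℕ} {e : Fin n × Fin n} : e ∈ touching n f s ↔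
    e.1 < e.2 ∧ ((e.1 : ℕ) ∈ Finset.Ico s (s + f) ∨ (e.2 : ℕ) ∈ Finset.Ico s (s + f)) := by
  simp [touching]

section IsolatedCopies

variable {p : ℕ → ℝ} {n f s : ℕ} {F : SimpleGraph (Fin f)}

lemma BlockEdge.mem {v w : ℕ} (h : BlockEdge F s v w) :
    v ∈ Finset.Ico s (s + f) ∧ w ∈ Finset.Ico s (s + f) := by
  obtain ⟨a, b, -, rfl, rfl⟩ := h
  simp

lemma isolatedAt_iff {G : SimpleGraph (Fin n)} : IsolatedAt F s G ↔
    ∀ e ∈ touching n f s, (G.Adj e.1 e.2 ↔ BlockEdge F s e.1 e.2) := by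
  simp only [IsolatedAt, mem_touching, Prod.forall, and_imp]

lemma eventProb_isolatedAt (p : ℕ → ℝ) (n : ℕ) (F : SimpleGraph (Fin f)) (s : ℕ) :
    eventProb p n (IsolatedAt F s) =
      ∏ e ∈ touching n f s, pairProb p e (BlockEdge F s e.1 e.2) := by
  rw [← eventProb_cylinder p _ (fun e he => (mem_touching.1 he).1)]
  congr 1
  funext G
  exact propext isolatedAt_iff

lemma card_mem_Ico_le (n f s : ℕ) :
    (Finset.univ.filter fun v : Fin n => (v : ℕ) ∈ Finset.Ico s (s + f)).card ≤ f := by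
  calc _ ≤ (Finset.Ico s (s + f)).card :=
        Finset.card_le_card_of_injOn (fun v : Fin n => (v : ℕ)) (by intro v; simp)
          (fun a _ b _ hab => Fin.ext hab)
    _ = f := by simp

lemma sum_load_touching_le (hp : ∀ i : ℕ, 1 ≤ i → 0 ≤ p i ∧ p i < 1) (n f s : ℕ) :
    ∑ e ∈ touching n f s, load p ((e.2 : ℕ) - (e.1 : ℕ)) ≤ 2 * f * totalLoad p n := by
  classical
  set I : Finset (Fin n) := Finset.univ.filter fun v : Fin n => (v : ℕ) ∈ Finset.Ico s (s + f)
    with hI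
  have hsub : touching n f s ⊆
      I ×ˢ Finset.univ ∪ Finset.univ ×ˢ I := by
    intro e he
    rw [mem_touching] at he
    simp only [hI, Finset.mem_union, Finset.mem_filter, Finset.mem_product, Finset.mem_univ,
      true_and, and_true]
    tauto
  have hbound : ∀ g : Fin n → ℝ, (∀ v, g v ≤ totalLoad p n) →
      ∑ v ∈ I, g v ≤ f * totalLoad p n := by
    intro g hg
    calc ∑ v ∈ I, g v ≤ I.card • totalLoad p n := Finset.sum_le_card_nsmul _ _ _ fun v _ => hg v
      _ ≤ f * totalLoad p n := by
        rw [nsmul_eq_mul]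
        exact mul_le_mul_of_nonneg_right (by exact_mod_cast card_mem_Ico_le n f s)
          (totalLoad_nonneg hp n)
  let L : Fin n × Fin n → ℝ := fun e => load p ((e.2 : ℕ) - (e.1 : ℕ))
  have hnn : ∀ e, 0 ≤ L e := fun _ => load_nonneg hp _
  calc ∑ e ∈ touching n f s, L e
      ≤ ∑ e ∈ I ×ˢ Finset.univ, L e + ∑ e ∈ Finset.univ ×ˢ I, L e := by
        refine (Finset.sum_le_sum_of_subset_of_nonneg hsub fun e _ _ => hnn e).trans ?_
        rw [← Finset.sum_union_inter]
        exact le_add_of_nonneg_right (Finset.sum_nonneg fun e _ => hnn e)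
    _ ≤ f * totalLoad p n + f * totalLoad p n := by
        rw [Finset.sum_product, Finset.sum_product_right]
        refine add_le_add (hbound _ fun v => ?_) (hbound _ fun w => ?_)
        · exact sum_load_le hp Finset.univ (fun w : Fin n => (w : ℕ) - (v : ℕ))
            (fun w _ => by omega) (fun w _ w' _ h h0 => Fin.ext (by omega))
        · exact sum_load_le hp Finset.univ (fun v : Fin n => (w : ℕ) - (v : ℕ))
            (fun w _ => by omega) (fun w _ w' _ h h0 => Fin.ext (by omega))
    _ = 2 * f * totalLoad p n := by ring

/-- Isolated copies cost at most a constant and twice the total load for each of the vertices. -/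
lemma exists_le_eventProb_isolatedAt (hp : ∀ i : ℕ, 1 ≤ i → 0 ≤ p i ∧ p i < 1)
    (hF : Supported p F) :
    ∃ c : ℝ, 0 < c ∧ ∀ n s : ℕ,
      c * Real.exp (-(2 * f * totalLoad p n)) ≤ eventProb p n (IsolatedAt F s) := by
  classical
  -- a common lower bound for the probabilities of the edges of `F`
  obtain ⟨c, hc, hc1, hcp⟩ : ∃ c : ℝ, 0 < c ∧ c ≤ 1 ∧
      ∀ i ∈ Finset.range f, 1 ≤ i → p i ≠ 0 → c ≤ p i := by
    generalize Finset.range f = T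
    induction T using Finset.induction with
    | empty => exact ⟨1, one_pos, le_rfl, by simp⟩
    | insert j T _ ih =>
      obtain ⟨c, hc, hc1, h⟩ := ih
      by_cases hj : 1 ≤ j ∧ p j ≠ 0
      · refine ⟨min c (p j), lt_min hc (lt_of_le_of_ne (hp j hj.1).1 hj.2.symm),
          (min_le_left _ _).trans hc1, fun i hi h1 h0 => ?_⟩
        rcases Finset.mem_insert.1 hi with rfl | hi
        · exact min_le_right _ _
        · exact (min_le_left _ _).trans (h i hi h1 h0)
      · refine ⟨c, hc, hc1, fun i hi h1 h0 => ?_⟩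
        rcases Finset.mem_insert.1 hi with rfl | hi
        · exact (hj ⟨h1, h0⟩).elim
        · exact h i hi h1 h0
  refine ⟨c ^ (f * f), by positivity, fun n s => ?_⟩
  have hlt : ∀ e ∈ touching n f s, e.1 < e.2 := fun e he => (mem_touching.1 he).1
  rw [eventProb_isolatedAt]
  have hcard : ((touching n f s).filter fun e => BlockEdge F s e.1 e.2).card ≤ f * f := by
    calc _ ≤ (Finset.Ico s (s + f) ×ˢ Finset.Ico s (s + f)).card := by
          refine Finset.card_le_card_of_injOn (fun e => ((e.1 : ℕ), (e.2 : ℕ))) ?_ ?_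
          · intro e he
            exact Finset.mem_coe.2 (Finset.mem_product.2 (Finset.mem_filter.1 he).2.mem)
          · rintro ⟨v, w⟩ _ ⟨v', w'⟩ _ h
            simpa [Fin.ext_iff] using h
      _ = f * f := by simp
  calc c ^ (f * f) * Real.exp (-(2 * f * totalLoad p n))
      ≤ (∏ e ∈ touching n f s, if BlockEdge F s e.1 e.2 then c else 1) *
        ∏ e ∈ touching n f s, (1 - p ((e.2 : ℕ) - (e.1 : ℕ))) := by
        rw [prod_one_sub_eq_exp hp _ hlt, ← Finset.prod_filter, Finset.prod_const]
        refine mul_le_mul (pow_le_pow_of_le_one hc.le hc1 hcard) ?_ (Real.exp_pos _).le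
          (by positivity)
        exact Real.exp_le_exp.2 (neg_le_neg (sum_load_touching_le hp n f s))
    _ ≤ _ := by
        rw [← Finset.prod_mul_distrib]
        refine Finset.prod_le_prod (fun e he => ?_) fun e he => ?_
        · have := hp ((e.2 : ℕ) - (e.1 : ℕ)) (by have := Fin.lt_def.1 (hlt e he); omega)
          refine mul_nonneg ?_ (by linarith)
          split_ifs <;> linarith
        · have := hp ((e.2 : ℕ) - (e.1 : ℕ)) (by have := Fin.lt_def.1 (hlt e he); omega)
          unfold pairProb
          split_ifs with h
          · obtain ⟨a, b, hab, h1, h2⟩ := h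
            have hab' : a < b := by
              have := Fin.lt_def.1 (hlt e he)
              rw [Fin.lt_def]
              omega
            have hd : (e.2 : ℕ) - (e.1 : ℕ) = b - a := by omega
            rw [hd] at this ⊢
            have h3 := hcp (b - a) (by rw [Finset.mem_range]; omega)
              (by rw [Fin.lt_def] at hab'; omega) (hF a b hab' hab)
            nlinarith
          · simp

/-- Isolated copies on disjoint intervals are nearly independent: their correlation comes from the
pairs that meet both intervals. -/
lemma eventProb_isolatedAt_and (hp : ∀ i : ℕ, 1 ≤ i → 0 ≤ p i ∧ p i < 1) {s s' : ℕ}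
    (h : s + f ≤ s' ∨ s' + f ≤ s) :
    eventProb p n (fun G => IsolatedAt F s G ∧ IsolatedAt F s' G) =
      Real.exp (∑ e ∈ touching n f s ∩ touching n f s', load p ((e.2 : ℕ) - (e.1 : ℕ))) *
        (eventProb p n (IsolatedAt F s) * eventProb p n (IsolatedAt F s')) := by
  classical
  have hlt : ∀ s, ∀ e ∈ touching n f s, e.1 < e.2 := fun s e he => (mem_touching.1 he).1
  have h1 : ∀ e ∈ touching n f s, ¬ BlockEdge F s' e.1 e.2 := by
    intro e he hb
    have := hb.mem
    simp only [mem_touching, Finset.mem_Ico] at he this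
    omega
  have h2 : ∀ e ∈ touching n f s', ¬ BlockEdge F s e.1 e.2 := by
    intro e he hb
    have := hb.mem
    simp only [mem_touching, Finset.mem_Ico] at he this
    omega
  let b : Fin n × Fin n → Prop := fun e => BlockEdge F s e.1 e.2 ∨ BlockEdge F s' e.1 e.2
  have hb1 : ∀ e ∈ touching n f s, (b e ↔ BlockEdge F s e.1 e.2) := fun e he =>
    or_iff_left (h1 e he)
  have hb2 : ∀ e ∈ touching n f s', (b e ↔ BlockEdge F s' e.1 e.2) := fun e he =>
    or_iff_right (h2 e he)
  have hand : eventProb p n (fun G => IsolatedAt F s G ∧ IsolatedAt F s' G) =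
      ∏ e ∈ touching n f s ∪ touching n f s', pairProb p e (b e) := by
    rw [← eventProb_cylinder p _ (fun e he => (Finset.mem_union.1 he).elim (hlt s e) (hlt s' e))]
    congr 1
    funext G
    rw [isolatedAt_iff, isolatedAt_iff, Finset.forall_mem_union]
    exact propext (and_congr (forall₂_congr fun e he => by rw [hb1 e he])
      (forall₂_congr fun e he => by rw [hb2 e he]))
  have hinter : ∏ e ∈ touching n f s ∩ touching n f s', pairProb p e (b e) =
      Real.exp (-∑ e ∈ touching n f s ∩ touching n f s', load p ((e.2 : ℕ) - (e.1 : ℕ))) := by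
    rw [← prod_one_sub_eq_exp hp _ fun e he => hlt s e (Finset.mem_inter.1 he).1]
    refine Finset.prod_congr rfl fun e he => ?_
    rw [Finset.mem_inter] at he
    exact if_neg fun hbe => hbe.elim (h2 e he.2) (h1 e he.1)
  have hmul := Finset.prod_union_inter (s₁ := touching n f s) (s₂ := touching n f s')
    (f := fun e => pairProb p e (b e))
  rw [← hand, hinter, Finset.prod_congr rfl fun e he => by rw [hb1 e he],
    Finset.prod_congr (s₁ := touching n f s') rfl fun e he => by rw [hb2 e he],
    ← eventProb_isolatedAt, ← eventProb_isolatedAt] at hmul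
  rw [← hmul, mul_left_comm, ← Real.exp_add, add_neg_cancel, Real.exp_zero, mul_one]

lemma card_filter_mem_Ico_le (T : Finset ℕ) (f v : ℕ) :
    (T.filter fun s => v ∈ Finset.Ico s (s + f)).card ≤ f := by
  calc _ ≤ (Finset.Ico (v + 1 - f) (v + 1)).card := by
        refine Finset.card_le_card fun s hs => ?_
        simp only [Finset.mem_filter, Finset.mem_Ico] at hs ⊢
        omega
    _ ≤ f := by simp; omega

/-- For a fixed interval, the correlations with all other intervals have a small sum. -/
lemma sum_sum_load_inter_le (hp : ∀ i : ℕ, 1 ≤ i → 0 ≤ p i ∧ p i < 1) (T : Finset ℕ) (n f s : ℕ) :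
    ∑ s' ∈ T, ∑ e ∈ touching n f s ∩ touching n f s', load p ((e.2 : ℕ) - (e.1 : ℕ)) ≤
      4 * f ^ 2 * totalLoad p n := by
  classical
  calc ∑ s' ∈ T, ∑ e ∈ touching n f s ∩ touching n f s', load p ((e.2 : ℕ) - (e.1 : ℕ))
      = ∑ e ∈ touching n f s,
        (T.filter fun s' => e ∈ touching n f s').card * load p ((e.2 : ℕ) - (e.1 : ℕ)) := by
        simp only [← Finset.filter_mem_eq_inter, Finset.sum_filter]
        rw [Finset.sum_comm]
        refine Finset.sum_congr rfl fun e _ => ?_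
        rw [← Finset.sum_filter, Finset.sum_const, nsmul_eq_mul]
    _ ≤ ∑ e ∈ touching n f s, (2 * f : ℝ) * load p ((e.2 : ℕ) - (e.1 : ℕ)) := by
        refine Finset.sum_le_sum fun e _ => mul_le_mul_of_nonneg_right ?_ (load_nonneg hp _)
        have hsub : (T.filter fun s' => e ∈ touching n f s') ⊆
            (T.filter fun s' => (e.1 : ℕ) ∈ Finset.Ico s' (s' + f)) ∪
              (T.filter fun s' => (e.2 : ℕ) ∈ Finset.Ico s' (s' + f)) := by
          intro s' hs'
          simp only [Finset.mem_filter, mem_touching, Finset.mem_union] at hs' ⊢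
          tauto
        have := (Finset.card_le_card hsub).trans (Finset.card_union_le _ _)
        have h1 := card_filter_mem_Ico_le T f e.1
        have h2 := card_filter_mem_Ico_le T f e.2
        exact_mod_cast this.trans (by omega)
    _ ≤ 2 * f * (2 * f * totalLoad p n) := by
        rw [← Finset.mul_sum]
        exact mul_le_mul_of_nonneg_left (sum_load_touching_le hp n f s) (by positivity)
    _ = 4 * f ^ 2 * totalLoad p n := by ring

/-- The second moment bound, with a tolerance `δ` for the correlation of two isolated copies. The
pairs of intervals with larger correlation are few, and their contribution is that of the second
summand. -/
lemma eventProb_no_isolated_mul_le (hp : ∀ i : ℕ, 1 ≤ i → 0 ≤ p i ∧ p i < 1) {δ : ℝ} (hδ : 0 < δ)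
    (n : ℕ) (F : SimpleGraph (Fin f)) (T : Finset ℕ) :
    eventProb p n (fun G => ∀ s ∈ T, ¬ IsolatedAt F s G) *
        (∑ s ∈ T, eventProb p n (IsolatedAt F s)) ^ 2 ≤
      (Real.exp δ - 1) * (∑ s ∈ T, eventProb p n (IsolatedAt F s)) ^ 2 +
      (∑ s ∈ T, eventProb p n (IsolatedAt F s)) *
        (4 * f ^ 2 * totalLoad p n / δ + 2 * f) := by
  classical
  refine (eventProb_none_mul_sq_le hp T (fun s => IsolatedAt F s)).trans ?_
  set P : ℕ → ℝ := fun s => eventProb p n (IsolatedAt F s) with hP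
  set μ := ∑ s ∈ T, P s with hμ
  let cross : ℕ → ℕ → ℝ := fun s s' =>
    ∑ e ∈ touching n f s ∩ touching n f s', load p ((e.2 : ℕ) - (e.1 : ℕ))
  have hP0 : ∀ s, 0 ≤ P s := fun s => eventProb_nonneg hp _
  have hc0 : ∀ s s', 0 ≤ cross s s' := fun s s' => Finset.sum_nonneg fun e _ => load_nonneg hp _
  have hle : ∀ s s', eventProb p n (fun G => IsolatedAt F s G ∧ IsolatedAt F s' G) ≤ P s :=
    fun s s' => eventProb_mono hp fun G _ h => h.1
  have hpair : ∀ s s', eventProb p n (fun G => IsolatedAt F s G ∧ IsolatedAt F s' G) ≤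
      Real.exp δ * (P s * P s') +
        P s * (cross s s' / δ + if s' < s + f ∧ s < s' + f then 1 else 0) := by
    intro s s'
    have h1 : 0 ≤ Real.exp δ * (P s * P s') :=
      mul_nonneg (Real.exp_pos _).le (mul_nonneg (hP0 s) (hP0 s'))
    have h2 : 0 ≤ cross s s' / δ := div_nonneg (hc0 s s') hδ.le
    -- overlapping or strongly correlated copies are bounded by the probability of one of them
    split_ifs with hov
    · nlinarith [hle s s', hP0 s]
    · by_cases hcr : cross s s' ≤ δ
      · rw [eventProb_isolatedAt_and hp (by omega)]
        refine le_add_of_le_of_nonneg ?_ (mul_nonneg (hP0 s) (by linarith))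
        exact mul_le_mul_of_nonneg_right (Real.exp_le_exp.2 hcr) (mul_nonneg (hP0 s) (hP0 s'))
      · have h3 : 1 ≤ cross s s' / δ := (one_le_div hδ).2 (not_le.1 hcr).le
        nlinarith [hle s s', hP0 s]
  have hrow : ∀ s, ∑ s' ∈ T, (cross s s' / δ + if s' < s + f ∧ s < s' + f then (1 : ℝ) else 0) ≤
      4 * f ^ 2 * totalLoad p n / δ + 2 * f := by
    intro s
    rw [Finset.sum_add_distrib, ← Finset.sum_div]
    refine add_le_add (div_le_div_of_nonneg_right (sum_sum_load_inter_le hp T n f s) hδ.le) ?_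
    rw [← Finset.sum_filter, Finset.sum_const, nsmul_eq_mul, mul_one]
    have : (T.filter fun s' => s' < s + f ∧ s < s' + f) ⊆ Finset.Ico (s + 1 - f) (s + f) := by
      intro s' hs'
      simp only [Finset.mem_filter, Finset.mem_Ico] at hs' ⊢
      omega
    have := Finset.card_le_card this
    rw [Nat.card_Ico] at this
    exact_mod_cast this.trans (by omega)
  calc ∑ s ∈ T, ∑ s' ∈ T, eventProb p n (fun G => IsolatedAt F s G ∧ IsolatedAt F s' G) - μ ^ 2
      ≤ ∑ s ∈ T, ∑ s' ∈ T, (Real.exp δ * (P s * P s') +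
        P s * (cross s s' / δ + if s' < s + f ∧ s < s' + f then 1 else 0)) - μ ^ 2 := by
        gcongr with s _ s' _
        exact hpair s s'
    _ = (Real.exp δ - 1) * μ ^ 2 + ∑ s ∈ T, P s * ∑ s' ∈ T,
        (cross s s' / δ + if s' < s + f ∧ s < s' + f then 1 else 0) := by
        rw [Finset.sum_congr rfl fun s _ => Finset.sum_add_distrib, Finset.sum_add_distrib]
        simp only [← Finset.mul_sum]
        rw [← Finset.sum_mul]
        ring
    _ ≤ (Real.exp δ - 1) * μ ^ 2 + ∑ s ∈ T, P s * (4 * f ^ 2 * totalLoad p n / δ + 2 * f) := by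
        gcongr with s _
        · exact hP0 s
        · exact hrow s
    _ = _ := by rw [← Finset.sum_mul]

/-- If the total load is below a small multiple of `log n`, then isolated copies of a possible
outcome `F` occur with probability near `1`. -/
lemma exists_eventProb_no_isolated_le (hp : ∀ i : ℕ, 1 ≤ i → 0 ≤ p i ∧ p i < 1)
    (hF : Supported p F) {η : ℝ} (hη : 0 < η) :
    ∃ n₀ : ℕ, ∀ n ≥ n₀, totalLoad p n ≤ Real.log n / (4 * f + 4) →
      eventProb p n (fun G => ∀ s ∈ Finset.range (n + 1 - f), ¬ IsolatedAt F s G) ≤ η := by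
  obtain ⟨c, hc, hPc⟩ := exists_le_eventProb_isolatedAt hp hF
  obtain ⟨δ, hδ, hδη⟩ : ∃ δ : ℝ, 0 < δ ∧ Real.exp δ - 1 ≤ η / 2 :=
    ⟨Real.log (1 + η / 2), Real.log_pos (by linarith), by
      rw [Real.exp_log (by linarith)]; linarith⟩
  -- the number of positions is at least `n / 2`, and each has probability at least `c / √n`
  have hasymp : ∀ᶠ n : ℕ in atTop,
      4 * f ^ 2 * Real.log n / δ + 2 * f ≤ (η / 2) * (c / 2 * (n : ℝ) ^ (1 / 2 : ℝ)) := by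
    have hlog : (fun x : ℝ => 4 * f ^ 2 * Real.log x / δ + 2 * f) =o[atTop]
        fun x : ℝ => x ^ (1 / 2 : ℝ) := by
      refine Asymptotics.IsLittleO.add ?_ ?_
      · have := (isLittleO_log_rpow_atTop (r := 1 / 2) (by norm_num)).const_mul_left
          (4 * (f : ℝ) ^ 2 / δ)
        refine this.congr_left fun x => by ring
      · rw [Asymptotics.isLittleO_const_left]
        exact .inr (tendsto_norm_atTop_atTop.comp (tendsto_rpow_atTop (by norm_num)))
    have h := (hlog.comp_tendsto tendsto_natCast_atTop_atTop).bound
      (show 0 < η / 2 * (c / 2) by positivity)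
    filter_upwards [h] with n hn
    simp only [Function.comp_apply, Real.norm_eq_abs] at hn
    rw [abs_of_nonneg (a := (n : ℝ) ^ (1 / 2 : ℝ)) (by positivity)] at hn
    linarith [le_abs_self (4 * (f : ℝ) ^ 2 * Real.log n / δ + 2 * f)]
  obtain ⟨n₀, hn₀⟩ := eventually_atTop.1 (hasymp.and (eventually_ge_atTop (2 * f + 1)))
  refine ⟨n₀, fun n hn hload => ?_⟩
  obtain ⟨hbig, hnf⟩ := hn₀ n hn
  have hn1 : (1 : ℝ) ≤ n := by exact_mod_cast (by omega : 1 ≤ n)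
  have hlog0 : 0 ≤ Real.log n := Real.log_nonneg hn1
  set μ := ∑ s ∈ Finset.range (n + 1 - f), eventProb p n (IsolatedAt F s) with hμ
  have hexp : (n : ℝ) ^ (-(1 / 2) : ℝ) ≤ Real.exp (-(2 * f * totalLoad p n)) := by
    rw [Real.rpow_def_of_pos (by linarith), Real.exp_le_exp]
    have : 2 * f * totalLoad p n ≤ 2 * f * (Real.log n / (4 * f + 4)) := by gcongr
    have h2 : 2 * f * (Real.log n / (4 * f + 4)) ≤ Real.log n * (1 / 2) := by
      rw [mul_div_assoc', div_le_iff₀ (by positivity)]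
      nlinarith [mul_nonneg hlog0 (Nat.cast_nonneg (α := ℝ) f)]
    linarith
  have hμ_ge : c / 2 * (n : ℝ) ^ (1 / 2 : ℝ) ≤ μ := by
    have hcount : (n : ℝ) / 2 ≤ ((n + 1 - f : ℕ) : ℝ) := by
      rw [div_le_iff₀ two_pos]
      exact_mod_cast (by omega : n ≤ (n + 1 - f) * 2)
    calc c / 2 * (n : ℝ) ^ (1 / 2 : ℝ) = (n : ℝ) / 2 * (c * (n : ℝ) ^ (-(1 / 2) : ℝ)) := by
          have : (n : ℝ) ^ (1 / 2 : ℝ) = n * (n : ℝ) ^ (-(1 / 2) : ℝ) := by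
            rw [← Real.rpow_one_add' (by linarith) (by norm_num)]
            norm_num
          rw [this]
          ring
      _ ≤ ((n + 1 - f : ℕ) : ℝ) * (c * Real.exp (-(2 * f * totalLoad p n))) := by gcongr
      _ = ∑ s ∈ Finset.range (n + 1 - f), c * Real.exp (-(2 * f * totalLoad p n)) := by simp
      _ ≤ μ := Finset.sum_le_sum fun s _ => hPc n s
  have hμ_pos : 0 < μ := lt_of_lt_of_le (by positivity) hμ_ge
  have hcheb := eventProb_no_isolated_mul_le hp hδ n F (Finset.range (n + 1 - f))
  rw [← hμ] at hcheb
  have hload' : totalLoad p n ≤ Real.log n := hload.trans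
    (div_le_self hlog0 (by linarith [Nat.cast_nonneg (α := ℝ) f]))
  have herr : 4 * f ^ 2 * totalLoad p n / δ + 2 * f ≤ η / 2 * μ := by
    calc 4 * f ^ 2 * totalLoad p n / δ + 2 * f ≤ 4 * f ^ 2 * Real.log n / δ + 2 * f := by gcongr
      _ ≤ η / 2 * (c / 2 * (n : ℝ) ^ (1 / 2 : ℝ)) := hbig
      _ ≤ η / 2 * μ := by gcongr
  refine le_of_mul_le_mul_right (hcheb.trans ?_) (pow_pos hμ_pos 2)
  nlinarith [mul_le_mul_of_nonneg_left herr hμ_pos.le,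
    mul_le_mul_of_nonneg_right hδη (pow_pos hμ_pos 2).le]

end IsolatedCopies

/-! ### The zero-one law -/

/-- Outcomes with an isolated copy of the absorbing graph `F` all satisfy the same sentences of the
given quantifier depth as `F`, and almost all outcomes are of this kind. -/
lemma tendsto_sentenceProb {p : ℕ → ℝ} (hp : ∀ i : ℕ, 1 ≤ i → 0 ≤ p i ∧ p i < 1)
    (hlim : Tendsto (fun n : ℕ => totalLoad p n / Real.log (n : ℝ)) atTop (𝓝 0))
    (ψ : FirstOrder.Language.graph.Sentence) :
    Tendsto (fun n : ℕ => sentenceProb p n ψ) atTop (𝓝 0) ∨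
      Tendsto (fun n : ℕ => sentenceProb p n ψ) atTop (𝓝 1) := by
  obtain ⟨f, F, hF, habs⟩ := exists_absorbing p (quantifierDepth ψ)
  have hload : ∀ᶠ n : ℕ in atTop, totalLoad p n ≤ Real.log n / (4 * f + 4) := by
    filter_upwards [hlim.eventually_le_const (show (0 : ℝ) < 1 / (4 * f + 4) by positivity),
      eventually_gt_atTop 1] with n hn h1
    rw [div_le_iff₀ (Real.log_pos (by exact_mod_cast h1))] at hn
    linarith [one_div_mul_eq_div (4 * (f : ℝ) + 4) (Real.log n)]
  have hnone : Tendsto (fun n => eventProb p n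
      (fun G => ∀ s ∈ Finset.range (n + 1 - f), ¬ IsolatedAt F s G)) atTop (𝓝 0) := by
    rw [tendsto_order]
    refine ⟨fun a ha => .of_forall fun n => ha.trans_le (eventProb_nonneg hp _), fun η hη => ?_⟩
    obtain ⟨n₀, hn₀⟩ := exists_eventProb_no_isolated_le hp hF (half_pos hη)
    filter_upwards [hload, eventually_ge_atTop n₀] with n h1 h2
    exact (hn₀ n h2 h1).trans_lt (half_lt_self hη)
  have hiff : ∀ n (G : SimpleGraph (Fin n)), Supported p G →
      (∃ s ∈ Finset.range (n + 1 - f), IsolatedAt F s G) → (Satisfies G ψ ↔ Satisfies F ψ) := by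
    rintro n G hG ⟨s, hs, hiso⟩
    rw [Finset.mem_range] at hs
    exact (hiso.roundEquiv habs hG (by omega)).satisfies_iff ψ
  by_cases hψ : Satisfies F ψ
  · right
    have h1 : Tendsto (fun n => 1 - eventProb p n
        (fun G => ∀ s ∈ Finset.range (n + 1 - f), ¬ IsolatedAt F s G)) atTop (𝓝 1) := by
      simpa using hnone.const_sub 1
    refine tendsto_of_tendsto_of_tendsto_of_le_of_le h1 tendsto_const_nhds (fun n => ?_)
      (fun n => eventProb_le_one hp _)
    have hadd := eventProb_add_not p (fun G : SimpleGraph (Fin n) => Satisfies G ψ)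
    have hle := eventProb_mono hp (A := fun G : SimpleGraph (Fin n) => ¬ Satisfies G ψ)
      (B := fun G => ∀ s ∈ Finset.range (n + 1 - f), ¬ IsolatedAt F s G) fun G hG hn s hs hiso =>
        hn ((hiff n G hG ⟨s, hs, hiso⟩).2 hψ)
    simp only [sentenceProb_eq]
    linarith
  · left
    refine tendsto_of_tendsto_of_tendsto_of_le_of_le tendsto_const_nhds hnone
      (fun n => eventProb_nonneg hp _) (fun n => ?_)
    exact eventProb_mono hp fun G hG hs s hsm hiso => hψ ((hiff n G hG ⟨s, hsm, hiso⟩).1 hs)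

/-! ### A sentence about small components -/

open FirstOrder Language in
/-- The sentence stating that there is a path `x 0, …, x r` with distinct vertices such that all
neighbours of its vertices lie on the path. -/
noncomputable def closedPathSentence (r : ℕ) : Language.graph.Sentence :=
  Formula.iExs (Fin (r + 1)) <|
    (Formula.iInf fun ij : {ij : Fin (r + 1) × Fin (r + 1) // ij.1 ≠ ij.2} =>
      ((Term.var (.inr ij.1.1)).equal (Term.var (.inr ij.1.2))).not) ⊓
    ((Formula.iInf fun i : Fin r =>
      adj.formula₂ (Term.var (.inr i.castSucc)) (Term.var (.inr i.succ))) ⊓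
    (Formula.iInf fun i : Fin (r + 1) => Formula.iAlls Unit <|
      (adj.formula₂ (Term.var (.inl (.inr i))) (Term.var (.inr ()))).imp <|
        Formula.iSup fun j : Fin (r + 1) =>
          (Term.var (.inr ())).equal (Term.var (.inl (.inr j)))))

lemma satisfies_closedPathSentence {V : Type} (G : SimpleGraph V) (r : ℕ) :
    Satisfies G (closedPathSentence r) ↔ ∃ x : Fin (r + 1) → V, Function.Injective x ∧
      (∀ i : Fin r, G.Adj (x i.castSucc) (x i.succ)) ∧
      ∀ i y, G.Adj (x i) y → ∃ j, y = x j := by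
  let := G.structure
  have hrel : ∀ v : Fin 2 → V,
      FirstOrder.Language.Structure.RelMap FirstOrder.Language.adj v ↔ G.Adj (v 0) (v 1) :=
    fun _ => Iff.rfl
  unfold Satisfies FirstOrder.Language.Sentence.Realize closedPathSentence
  rw [FirstOrder.Language.Formula.realize_iExs]
  refine exists_congr fun x => ?_
  simp only [FirstOrder.Language.Formula.realize_inf, FirstOrder.Language.Formula.realize_iInf,
    FirstOrder.Language.Formula.realize_not, FirstOrder.Language.Formula.realize_equal,
    FirstOrder.Language.Formula.realize_rel₂, FirstOrder.Language.Term.realize_var, hrel,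
    FirstOrder.Language.Formula.realize_iAlls, FirstOrder.Language.Formula.realize_imp,
    FirstOrder.Language.Formula.realize_iSup, Sum.elim_inr, Sum.elim_inl]
  refine and_congr ?_ (and_congr Iff.rfl ?_)
  · exact ⟨fun h i j hij => by_contra fun hne => h ⟨(i, j), hne⟩ hij,
      fun h ij hij => ij.2 (h hij)⟩
  · exact forall_congr' fun i => ⟨fun h y => h fun _ => y, fun h y => h (y ())⟩

/-- An isolated copy of the path on `r + 1` vertices satisfies `closedPathSentence r`. -/
lemma IsolatedAt.satisfies_closedPathSentence {n r s : ℕ} {G : SimpleGraph (Fin n)}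
    (h : IsolatedAt (SimpleGraph.pathGraph (r + 1)) s G) (hs : s + (r + 1) ≤ n) :
    Satisfies G (closedPathSentence r) := by
  rw [DistanceRandomGraph.satisfies_closedPathSentence]
  refine ⟨fun i => ⟨s + i, by omega⟩, fun i j hij => Fin.ext (by simpa using hij), fun i => ?_,
    fun i y hy => ?_⟩
  · rw [h.adj_iff hs]
    refine ⟨i.succ, rfl, ?_⟩
    rw [SimpleGraph.pathGraph_adj]
    simp
  · obtain ⟨j, hj, -⟩ := (h.adj_iff hs i y).1 hy
    exact ⟨j, Fin.ext hj⟩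

/-! ### The sentence fails when long blocks of distances are likely -/

/-- A sequence of vertices is determined by its first vertex and its steps. -/
lemma card_le_of_steps {n r : ℕ} (E : Finset ℤ) (X : Finset (Fin (r + 1) → Fin n))
    (hX : ∀ x ∈ X, ∀ i : Fin r, ((x i.succ : ℕ) : ℤ) - ((x i.castSucc : ℕ) : ℤ) ∈ E) :
    X.card ≤ n * E.card ^ r := by
  calc X.card ≤ ((Finset.univ : Finset (Fin n)) ×ˢ Fintype.piFinset fun _ : Fin r => E).card := by
        refine Finset.card_le_card_of_injOn (fun x => (x 0, fun i : Fin r =>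
          ((x i.succ : ℕ) : ℤ) - ((x i.castSucc : ℕ) : ℤ))) ?_ ?_
        · intro x hx
          simpa using hX x hx
        · intro x _ y _ hxy
          simp only [Prod.mk.injEq, funext_iff] at hxy
          funext i
          induction i using Fin.induction with
          | zero => exact hxy.1
          | succ i ih =>
            have := hxy.2 i
            rw [ih] at this
            exact Fin.ext (by omega)
    _ = n * E.card ^ r := by simp

open Classical in
/-- The pairs with exactly one element among the vertices `x i`. -/
noncomputable def boundaryPairs {n r : ℕ} (x : Fin (r + 1) → Fin n) : Finset (Fin n × Fin n) :=
  {e | e.1 < e.2 ∧ (e.1 ∈ Set.range x ↔ e.2 ∉ Set.range x)}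

/-- In `G(4 * N, p)` every vertex has, on one of its two sides, a vertex at every distance below
`2 * N`; so there are many pairs at these distances on the boundary of a set of vertices. -/
lemma le_card_boundaryPairs {N L r : ℕ} (hL : L ≤ N) (x : Fin (r + 1) → Fin (4 * N))
    (hx : Function.Injective x) :
    (r + 1) * (L - (r + 1)) ≤ ((boundaryPairs x).filter fun e =>
      (e.2 : ℕ) - (e.1 : ℕ) ∈ Finset.Ico N (N + L)).card := by
  classical
  let W : Fin (r + 1) → Finset (Fin (4 * N)) := fun i => Finset.univ.filter fun w =>
    w ∉ Set.range x ∧ (((w : ℕ) - (x i : ℕ) ∈ Finset.Ico N (N + L)) ∨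
      ((x i : ℕ) - (w : ℕ) ∈ Finset.Ico N (N + L)))
  have hW : ∀ i, L - (r + 1) ≤ (W i).card := by
    intro i
    let g : Fin L → Fin (4 * N) := fun j =>
      if h : (x i : ℕ) < 2 * N then ⟨x i + (N + j), by omega⟩ else ⟨x i - (N + j), by omega⟩
    have hg : Function.Injective g := by
      intro j j' h
      have := Fin.ext_iff.1 h
      simp only [g] at this
      split_ifs at this <;> exact Fin.ext (by simp only at this; omega)
    calc L - (r + 1) ≤ (Finset.univ.image g \ Finset.univ.image x).card := by
          refine le_trans ?_ (Finset.le_card_sdiff _ _)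
          rw [Finset.card_image_of_injective _ hg, Finset.card_image_of_injective _ hx]
          simp
      _ ≤ (W i).card := by
          refine Finset.card_le_card fun w hw => ?_
          simp only [Finset.mem_sdiff, Finset.mem_image, Finset.mem_univ, true_and] at hw
          obtain ⟨⟨j, rfl⟩, hnot⟩ := hw
          simp only [W, Finset.mem_filter, Finset.mem_univ, true_and, Set.mem_range]
          refine ⟨hnot, ?_⟩
          simp only [g, Finset.mem_Ico]
          split_ifs <;> simp only <;> omega
  calc (r + 1) * (L - (r + 1)) = ∑ _i : Fin (r + 1), (L - (r + 1)) := by simp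
    _ ≤ ∑ i, (W i).card := Finset.sum_le_sum fun i _ => hW i
    _ = (Finset.univ.sigma W).card := (Finset.card_sigma _ _).symm
    _ ≤ _ := by
        have hmem : ∀ a ∈ Finset.univ.sigma W, a.2 ∉ Set.range x ∧ x a.1 ≠ a.2 := by
          intro a ha
          have := (Finset.mem_filter.1 (Finset.mem_sigma.1 ha).2).2.1
          exact ⟨this, fun h => this ⟨_, h⟩⟩
        refine Finset.card_le_card_of_injOn
          (fun a => if x a.1 < a.2 then (x a.1, a.2) else (a.2, x a.1)) ?_ ?_
        · intro a ha
          obtain ⟨h1, h2⟩ := hmem a ha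
          have h3 := (Finset.mem_filter.1 (Finset.mem_sigma.1 ha).2).2.2
          simp only [Finset.mem_Ico] at h3
          have h4 : (x a.1 : ℕ) ≠ a.2 := fun h => h2 (Fin.ext h)
          refine Finset.mem_coe.2 (Finset.mem_filter.2 ?_)
          simp only [boundaryPairs, Finset.mem_filter, Finset.mem_univ, true_and, Finset.mem_Ico]
          split_ifs with h <;> rw [Fin.lt_def] at h
          · exact ⟨⟨Fin.lt_def.2 h, iff_of_true ⟨_, rfl⟩ h1⟩, by dsimp only; omega⟩
          · exact ⟨⟨Fin.lt_def.2 (by dsimp only; omega), iff_of_false h1 (not_not.2 ⟨_, rfl⟩)⟩,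
              by dsimp only; omega⟩
        · rintro ⟨i, v⟩ ha ⟨j, w⟩ hb hab
          have hv := (hmem _ ha).1
          have hw := (hmem _ hb).1
          simp only at hab hv hw
          split_ifs at hab <;> simp only [Prod.mk.injEq] at hab
          · obtain rfl := hx hab.1
            rw [hab.2]
          · exact (hw ⟨i, hab.1⟩).elim
          · exact (hv ⟨j, hab.1.symm⟩).elim
          · obtain rfl := hx hab.2
            rw [hab.1]

/-- The union bound over the at most `4 * N * (2 * m) ^ r` paths with possible steps. -/
lemma sentenceProb_closedPath_le {p : ℕ → ℝ} (hp : ∀ i : ℕ, 1 ≤ i → 0 ≤ p i ∧ p i < 1)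
    {N L r m : ℕ} (hL : L ≤ N) (hblock : ∀ i ∈ Finset.Ico N (N + L), 1 / 2 ≤ p i)
    (D : Finset ℕ) (hD : ∀ i, 1 ≤ i → i ≤ 4 * N → p i ≠ 0 → i ∈ D) (hm : D.card ≤ m) :
    sentenceProb p (4 * N) (closedPathSentence r) ≤
      4 * N * (2 * m) ^ r * (1 / 2) ^ ((r + 1) * (L - (r + 1))) := by
  classical
  let E : Finset ℤ := D.image (fun i : ℕ => (i : ℤ)) ∪ D.image (fun i : ℕ => -(i : ℤ))
  have hE : E.card ≤ 2 * m := by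
    have h1 : (D.image (fun i : ℕ => (i : ℤ))).card ≤ D.card := Finset.card_image_le
    have h2 : (D.image (fun i : ℕ => -(i : ℤ))).card ≤ D.card := Finset.card_image_le
    exact (Finset.card_union_le _ _).trans (by omega)
  let X : Finset (Fin (r + 1) → Fin (4 * N)) := Finset.univ.filter fun x =>
    Function.Injective x ∧ ∀ i : Fin r, ((x i.succ : ℕ) : ℤ) - ((x i.castSucc : ℕ) : ℤ) ∈ E
  have hX : X.card ≤ 4 * N * (2 * m) ^ r :=
    (card_le_of_steps E X fun x hx => (Finset.mem_filter.1 hx).2.2).trans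
      (Nat.mul_le_mul_left _ (Nat.pow_le_pow_left hE r))
  let B : (Fin (r + 1) → Fin (4 * N)) → SimpleGraph (Fin (4 * N)) → Prop := fun x G =>
    ∀ e ∈ boundaryPairs x, (G.Adj e.1 e.2 ↔ False)
  have hlt : ∀ x : Fin (r + 1) → Fin (4 * N), ∀ e ∈ boundaryPairs x, e.1 < e.2 :=
    fun x e he => (Finset.mem_filter.1 he).2.1
  have hB : ∀ x ∈ X, eventProb p (4 * N) (B x) ≤ (1 / 2) ^ ((r + 1) * (L - (r + 1))) := by
    intro x hx
    rw [eventProb_cylinder p _ (hlt x)]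
    calc ∏ e ∈ boundaryPairs x, pairProb p e False
        ≤ ∏ e ∈ boundaryPairs x,
          if (e.2 : ℕ) - (e.1 : ℕ) ∈ Finset.Ico N (N + L) then (1 / 2 : ℝ) else 1 := by
          refine Finset.prod_le_prod (fun e he => pairProb_nonneg hp (hlt x e he) _)
            fun e he => ?_
          have h1 := hp ((e.2 : ℕ) - (e.1 : ℕ)) (by have := Fin.lt_def.1 (hlt x e he); omega)
          simp only [pairProb, if_false]
          split_ifs with h
          · linarith [hblock _ h]
          · linarith
      _ = (1 / 2) ^ ((boundaryPairs x).filter fun e =>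
          (e.2 : ℕ) - (e.1 : ℕ) ∈ Finset.Ico N (N + L)).card := by
          rw [← Finset.prod_filter, Finset.prod_const]
      _ ≤ (1 / 2) ^ ((r + 1) * (L - (r + 1))) :=
          pow_le_pow_of_le_one (by norm_num) (by norm_num)
            (le_card_boundaryPairs hL x (Finset.mem_filter.1 hx).2.1)
  calc sentenceProb p (4 * N) (closedPathSentence r)
      ≤ eventProb p (4 * N) (fun G => ∃ x ∈ X, B x G) := by
        refine eventProb_mono hp fun G hG hsat => ?_
        obtain ⟨x, hinj, hadj, hcl⟩ := (satisfies_closedPathSentence G r).1 hsat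
        refine ⟨x, Finset.mem_filter.2 ⟨Finset.mem_univ _, hinj, fun i => ?_⟩, fun e he => ?_⟩
        · have h0 := hadj i
          rcases lt_trichotomy (x i.castSucc) (x i.succ) with hlt' | heq | hlt'
          · have h1 := hG _ _ hlt' h0
            rw [Fin.lt_def] at hlt'
            refine Finset.mem_union_left _ (Finset.mem_image.2 ⟨_, hD _ ?_ ?_ h1, ?_⟩) <;> omega
          · exact (h0.ne heq).elim
          · have h1 := hG _ _ hlt' h0.symm
            rw [Fin.lt_def] at hlt'
            refine Finset.mem_union_right _ (Finset.mem_image.2 ⟨_, hD _ ?_ ?_ h1, ?_⟩) <;> omega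
        · simp only [iff_false]
          intro hG'
          obtain ⟨-, h1⟩ := (Finset.mem_filter.1 he).2
          by_cases h2 : e.1 ∈ Set.range x
          · obtain ⟨i, hi⟩ := h2
            obtain ⟨j, hj⟩ := hcl i e.2 (hi ▸ hG')
            exact h1.1 ⟨i, hi⟩ ⟨j, hj.symm⟩
          · have h3 : e.2 ∈ Set.range x := by_contra fun h3 => h2 (h1.2 h3)
            obtain ⟨i, hi⟩ := h3
            obtain ⟨j, hj⟩ := hcl i e.1 (hi ▸ hG'.symm)
            exact h2 ⟨j, hj.symm⟩
    _ ≤ ∑ x ∈ X, eventProb p (4 * N) (B x) := eventProb_exists_le hp X B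
    _ ≤ X.card • (1 / 2 : ℝ) ^ ((r + 1) * (L - (r + 1))) := Finset.sum_le_card_nsmul _ _ _ hB
    _ ≤ _ := by
        rw [nsmul_eq_mul]
        refine mul_le_mul_of_nonneg_right ?_ (by positivity)
        exact_mod_cast hX

/-! ### A sequence without convergence -/

/-- The length of the `k`-th block of distances. Any sequence whose quotients tend to infinity
would do. -/
def blockLength (k : ℕ) : ℕ := (k + 1).factorial

/-- The first distance of the `k`-th block. -/
def blockStart (r k : ℕ) : ℕ := 2 ^ (r * blockLength k)

open Classical in
/-- Probability `1 / 2` on the blocks of distances, a small positive probability at distance `1`,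
and `0` elsewhere. -/
noncomputable def blockProb (a : ℝ) (r i : ℕ) : ℝ :=
  if i = 1 then a
  else if ∃ k, i ∈ Finset.Ico (blockStart r k) (blockStart r k + blockLength k) then 1 / 2 else 0

lemma blockLength_pos (k : ℕ) : 0 < blockLength k := Nat.factorial_pos _

lemma blockLength_succ (k : ℕ) : blockLength (k + 1) = (k + 2) * blockLength k :=
  Nat.factorial_succ (k + 1)

lemma blockLength_strictMono : StrictMono blockLength := by
  refine strictMono_nat_of_lt_succ fun k => ?_
  rw [blockLength_succ]
  nlinarith [blockLength_pos k]

lemma blockStart_strictMono {r : ℕ} (hr : 1 ≤ r) : StrictMono (blockStart r) := fun _ _ h =>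
  Nat.pow_lt_pow_right one_lt_two (Nat.mul_lt_mul_of_pos_left (blockLength_strictMono h) hr)

lemma sum_blockLength_le (k : ℕ) :
    ∑ j ∈ Finset.range (k + 1), blockLength j ≤ 2 * blockLength k := by
  induction k with
  | zero => simp [blockLength]
  | succ k ih =>
    rw [Finset.sum_range_succ, blockLength_succ]
    nlinarith [blockLength_pos k]

/-- The distances in the first `K` blocks. -/
def firstBlocks (r K : ℕ) : Finset ℕ :=
  (Finset.range K).biUnion fun k => Finset.Ico (blockStart r k) (blockStart r k + blockLength k)

lemma card_firstBlocks_le (r K : ℕ) :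
    (firstBlocks r K).card ≤ ∑ k ∈ Finset.range K, blockLength k := by
  refine Finset.card_biUnion_le.trans (le_of_eq ?_)
  simp

section BlockProb

variable {a : ℝ} {r : ℕ}

lemma blockProb_one (a : ℝ) (r : ℕ) : blockProb a r 1 = a := if_pos rfl

lemma blockProb_bounds (ha : 0 < a) (ha1 : a < 1) (i : ℕ) (_ : 1 ≤ i) :
    0 ≤ blockProb a r i ∧ blockProb a r i < 1 := by
  unfold blockProb
  split_ifs <;> constructor <;> linarith

lemma blockProb_of_mem (hr : 1 ≤ r) (k : ℕ)
    {i : ℕ} (hi : i ∈ Finset.Ico (blockStart r k) (blockStart r k + blockLength k)) :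
    blockProb a r i = 1 / 2 := by
  have : 2 ≤ blockStart r k :=
    Nat.le_self_pow (Nat.mul_ne_zero (by omega) (blockLength_pos k).ne') 2
  rw [blockProb, if_neg, if_pos ⟨k, hi⟩]
  rw [Finset.mem_Ico] at hi
  omega

lemma mem_firstBlocks (hr : 1 ≤ r) {i K : ℕ} (hi : i ≠ 1) (h : blockProb a r i ≠ 0)
    (hK : i < blockStart r K) : i ∈ firstBlocks r K := by
  rw [blockProb, if_neg hi] at h
  split_ifs at h with hk
  · obtain ⟨k, hk⟩ := hk
    refine Finset.mem_biUnion.2 ⟨k, Finset.mem_range.2 ?_, hk⟩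
    exact (blockStart_strictMono hr).lt_iff_lt.1 ((Finset.mem_Ico.1 hk).1.trans_lt hK)
  · exact (h rfl).elim

/-- Below the `K`-th block, only distance `1` and the earlier blocks contribute to the load. -/
lemma totalLoad_blockProb_le (hr : 1 ≤ r) (ha : 0 < a) (ha1 : a < 1) {n K : ℕ}
    (hK : n < blockStart r K) :
    totalLoad (blockProb a r) n ≤
      -Real.log (1 - a) + Real.log 2 * ∑ k ∈ Finset.range K, blockLength k := by
  classical
  have hp := blockProb_bounds (r := r) ha ha1
  have hle : ∀ i ∈ Finset.range (n + 1), load (blockProb a r) i ≤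
      (if i = 1 then -Real.log (1 - a) else 0) + if i ∈ firstBlocks r K then Real.log 2 else 0 := by
    intro i hi
    have hlog : 0 ≤ Real.log 2 := Real.log_nonneg one_le_two
    by_cases h1 : i = 1
    · subst h1
      rw [load, if_neg one_ne_zero, blockProb_one, if_pos rfl]
      split_ifs <;> linarith
    · rw [if_neg h1, zero_add]
      by_cases h0 : blockProb a r i = 0
      · have : load (blockProb a r) i = 0 := by simp [load, h0]
        rw [this]
        split_ifs <;> linarith
      · rw [if_pos (mem_firstBlocks hr h1 h0 (by rw [Finset.mem_range] at hi; omega))]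
        rw [blockProb, if_neg h1] at h0
        have hhalf : blockProb a r i = 1 / 2 := by
          rw [blockProb, if_neg h1]
          split_ifs at h0 ⊢
          · rfl
          · exact (h0 rfl).elim
        rw [load, hhalf]
        split_ifs
        · exact hlog
        · rw [show (1 : ℝ) - 1 / 2 = 2⁻¹ by norm_num, Real.log_inv, neg_neg]
  have hneg : 0 ≤ -Real.log (1 - a) := by
    linarith [Real.log_nonpos (x := 1 - a) (by linarith) (by linarith)]
  calc totalLoad (blockProb a r) n ≤ _ := Finset.sum_le_sum hle
    _ ≤ -Real.log (1 - a) + Real.log 2 * (firstBlocks r K).card := by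
        rw [Finset.sum_add_distrib]
        refine add_le_add ?_ ?_
        · rw [Finset.sum_ite_eq']
          split_ifs <;> linarith
        · rw [← Finset.sum_filter, Finset.sum_const, nsmul_eq_mul, mul_comm]
          refine mul_le_mul_of_nonneg_left ?_ (Real.log_nonneg one_le_two)
          exact_mod_cast Finset.card_le_card fun i hi => (Finset.mem_filter.1 hi).2
    _ ≤ _ := by
        gcongr
        exact_mod_cast card_firstBlocks_le r K

lemma log_blockStart (r k : ℕ) :
    Real.log (blockStart r k) = r * blockLength k * Real.log 2 := by
  simp [blockStart, Real.log_pow]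

lemma totalLoad_blockProb_lt (hr : 1 ≤ r) (ha : 0 < a) (ha1 : a < 1) {ε : ℝ} (hrε : 4 ≤ r * ε)
    (haε : -Real.log (1 - a) < ε / 2 * Real.log 2) {n : ℕ} (hn : 2 ≤ n) :
    totalLoad (blockProb a r) n < ε * Real.log n := by
  have hlog2 : 0 < Real.log 2 := Real.log_pos one_lt_two
  have hlogn : Real.log 2 ≤ Real.log n := Real.log_le_log two_pos (by exact_mod_cast hn)
  have hrpos : (0 : ℝ) < r := by exact_mod_cast hr
  have hε : 0 < ε := by
    by_contra! h
    nlinarith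
  have hex : ∃ K, n < blockStart r K := by
    have := (blockStart_strictMono hr).tendsto_atTop.eventually_gt_atTop n
    exact this.exists
  -- with `k` the last block that starts at or below `n`, compare `n` with the start of this block
  classical
  have hlow : ∀ j < Nat.find hex, blockStart r j ≤ n := fun j hj => not_lt.1 (Nat.find_min hex hj)
  have hload := totalLoad_blockProb_le hr ha ha1 (Nat.find_spec hex)
  rcases h : Nat.find hex with _ | k
  · rw [h] at hload
    simp only [Finset.range_zero, Finset.sum_empty, Nat.cast_zero, mul_zero, add_zero] at hload
    nlinarith
  · rw [h] at hload
    have h1 : r * blockLength k * Real.log 2 ≤ Real.log n := by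
      rw [← log_blockStart]
      refine Real.log_le_log ?_ (by exact_mod_cast hlow k (by omega))
      exact_mod_cast Nat.pow_pos two_pos
    have h2 : ((∑ j ∈ Finset.range (k + 1), blockLength j : ℕ) : ℝ) ≤ 2 * blockLength k := by
      exact_mod_cast sum_blockLength_le k
    push_cast at h2
    have h3 : Real.log 2 * ∑ j ∈ Finset.range (k + 1), (blockLength j : ℝ) ≤
        ε / 2 * Real.log n := by
      have h4 : 4 * (blockLength k * Real.log 2) ≤ r * ε * (blockLength k * Real.log 2) :=
        mul_le_mul_of_nonneg_right hrε (by positivity)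
      nlinarith
    push_cast at hload
    nlinarith

/-- Long before the next block the load is negligible, so isolated copies of paths occur. -/
lemma eventually_sentenceProb_blockProb_ge (hr : 2 ≤ r) (ha : 0 < a) (ha1 : a < 1) {η : ℝ}
    (hη : 0 < η) : ∀ᶠ k in atTop,
      1 - η ≤ sentenceProb (blockProb a r) (2 ^ blockLength k) (closedPathSentence r) := by
  have hp := blockProb_bounds (r := r) ha ha1
  have hlog2 : 0 < Real.log 2 := Real.log_pos one_lt_two
  have hF : Supported (blockProb a r) (SimpleGraph.pathGraph (r + 1)) := by
    intro v w hvw hadj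
    rw [SimpleGraph.pathGraph_adj] at hadj
    rw [Fin.lt_def] at hvw
    rw [show (w : ℕ) - v = 1 by omega, blockProb_one]
    exact ha.ne'
  obtain ⟨n₀, hn₀⟩ := exists_eventProb_no_isolated_le hp hF hη
  have htop : Tendsto (fun k => 2 ^ blockLength k) atTop atTop :=
    ((pow_right_strictMono₀ (one_lt_two (α := ℕ))).comp blockLength_strictMono).tendsto_atTop
  obtain ⟨M, hM⟩ := exists_nat_ge
    ((-Real.log (1 - a) + 2 * Real.log 2) * (4 * ((r + 1 : ℕ) : ℝ) + 4) / Real.log 2)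
  filter_upwards [htop.eventually_ge_atTop n₀, eventually_ge_atTop (M + 1)] with k hk hkM
  obtain ⟨m, rfl⟩ : ∃ m, k = m + 1 := ⟨k - 1, by omega⟩
  have hneg : 0 ≤ -Real.log (1 - a) := by
    linarith [Real.log_nonpos (x := 1 - a) (by linarith) (by linarith)]
  have hload : totalLoad (blockProb a r) (2 ^ blockLength (m + 1)) ≤
      Real.log ((2 ^ blockLength (m + 1) : ℕ) : ℝ) / (4 * ((r + 1 : ℕ) : ℝ) + 4) := by
    have h1 := totalLoad_blockProb_le (r := r) (n := 2 ^ blockLength (m + 1)) (K := m + 1)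
      (by omega) ha ha1
      (Nat.pow_lt_pow_right one_lt_two (by nlinarith [blockLength_pos (m + 1)]))
    have h2 : ((∑ j ∈ Finset.range (m + 1), blockLength j : ℕ) : ℝ) ≤ 2 * blockLength m := by
      exact_mod_cast sum_blockLength_le m
    have h3 : (1 : ℝ) ≤ blockLength m := by exact_mod_cast blockLength_pos m
    have h4 : (M : ℝ) ≤ m := by exact_mod_cast (by omega : M ≤ m)
    rw [div_le_iff₀ hlog2] at hM
    have h6 : Real.log ((2 ^ blockLength (m + 1) : ℕ) : ℝ) =
        (m + 2) * blockLength m * Real.log 2 := by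
      rw [Nat.cast_pow, Real.log_pow, blockLength_succ]
      push_cast
      rfl
    rw [le_div_iff₀ (by positivity), h6]
    push_cast at h1 h2 hM ⊢
    have h5 : totalLoad (blockProb a r) (2 ^ blockLength (m + 1)) ≤
        (-Real.log (1 - a) + 2 * Real.log 2) * blockLength m := by nlinarith
    calc _ ≤ (-Real.log (1 - a) + 2 * Real.log 2) * blockLength m * (4 * ((r : ℝ) + 1) + 4) := by
          gcongr
      _ = (-Real.log (1 - a) + 2 * Real.log 2) * (4 * ((r : ℝ) + 1) + 4) * blockLength m := by ring
      _ ≤ (M * Real.log 2) * blockLength m := by gcongr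
      _ ≤ ((m + 2) * Real.log 2) * blockLength m := by gcongr; linarith
      _ = _ := by ring
  have hnone := hn₀ _ hk hload
  have hadd := eventProb_add_not (blockProb a r)
    (fun G : SimpleGraph (Fin (2 ^ blockLength (m + 1))) => Satisfies G (closedPathSentence r))
  have hle := eventProb_mono hp
    (A := fun G : SimpleGraph (Fin (2 ^ blockLength (m + 1))) =>
      ¬ Satisfies G (closedPathSentence r))
    (B := fun G => ∀ s ∈ Finset.range (2 ^ blockLength (m + 1) + 1 - (r + 1)),
      ¬ IsolatedAt (SimpleGraph.pathGraph (r + 1)) s G) fun G _ hn s hs hiso =>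
        hn (hiso.satisfies_closedPathSentence (by rw [Finset.mem_range] at hs; omega))
  rw [sentenceProb_eq]
  linarith

/-- Right after a block each of the `r + 1` vertices of a path is cut off with probability at most
about `2 ^ (-L)`, which beats the number of paths, about `2 ^ (r * L)`. -/
lemma tendsto_sentenceProb_blockProb (hr : 3 ≤ r) (ha : 0 < a) (ha1 : a < 1) :
    Tendsto (fun k => sentenceProb (blockProb a r) (4 * blockStart r k) (closedPathSentence r))
      atTop (𝓝 0) := by
  have hp := blockProb_bounds (r := r) ha ha1
  let C : ℝ := 4 * 6 ^ r * 2 ^ ((r + 1) * (r + 1))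
  have hlim : Tendsto (fun k => C * ((blockLength k : ℝ) ^ r * (1 / 2) ^ blockLength k))
      atTop (𝓝 0) := by
    have h := (tendsto_pow_const_mul_const_pow_of_abs_lt_one r
      (show |(1 / 2 : ℝ)| < 1 by norm_num [abs_of_pos])).comp blockLength_strictMono.tendsto_atTop
    simpa using h.const_mul C
  refine tendsto_of_tendsto_of_tendsto_of_le_of_le' tendsto_const_nhds hlim
    (.of_forall fun k => eventProb_nonneg hp _) ?_
  filter_upwards [blockLength_strictMono.tendsto_atTop.eventually_ge_atTop (r + 1)] with k hk
  set L := blockLength k with hL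
  have hL1 : 1 ≤ L := blockLength_pos k
  have hnext : 4 * blockStart r k < blockStart r (k + 1) := by
    have h1 : 2 + r * L < r * blockLength (k + 1) := by
      rw [blockLength_succ, ← hL]
      nlinarith [mul_le_mul hr hL1 zero_le_one (by omega)]
    calc 4 * blockStart r k = 2 ^ (2 + r * L) := by rw [blockStart, pow_add, ← hL]; norm_num
      _ < _ := Nat.pow_lt_pow_right one_lt_two h1
  have hLN : L ≤ blockStart r k :=
    (Nat.lt_two_pow_self (n := L)).le.trans (Nat.pow_le_pow_right two_pos (by nlinarith))
  have hcard : (insert 1 (firstBlocks r (k + 1))).card ≤ 3 * L :=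
    (Finset.card_insert_le _ _).trans (by
      have := (card_firstBlocks_le r (k + 1)).trans (sum_blockLength_le k)
      omega)
  refine (sentenceProb_closedPath_le hp hLN
    (fun i hi => (blockProb_of_mem (by omega) k hi).ge) (insert 1 (firstBlocks r (k + 1)))
    (fun i _ hi h0 => ?_) hcard).trans (le_of_eq ?_)
  · by_cases h1 : i = 1
    · exact Finset.mem_insert.2 (.inl h1)
    · exact Finset.mem_insert_of_mem (mem_firstBlocks (by omega) h1 h0 (by omega))
  · have h1 : (r + 1) * (L - (r + 1)) + (r + 1) * (r + 1) = r * L + L := by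
      rw [← Nat.mul_add, Nat.sub_add_cancel hk]
      ring
    have h2 : (1 / 2 : ℝ) ^ ((r + 1) * (L - (r + 1))) =
        2 ^ ((r + 1) * (r + 1)) * ((1 / 2) ^ (r * L) * (1 / 2) ^ L) := by
      rw [← pow_add, ← h1, pow_add, mul_left_comm, ← mul_pow]
      norm_num
    have h3 : (2 : ℝ) ^ (r * L) * (1 / 2) ^ (r * L) = 1 := by
      rw [← mul_pow]
      norm_num
    rw [h2, blockStart, ← hL]
    push_cast
    calc 4 * (2 : ℝ) ^ (r * L) * (2 * (3 * L)) ^ r *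
          (2 ^ ((r + 1) * (r + 1)) * ((1 / 2) ^ (r * L) * (1 / 2) ^ L))
        = 4 * 6 ^ r * 2 ^ ((r + 1) * (r + 1)) * ((L : ℝ) ^ r * (1 / 2) ^ L) *
          (2 ^ (r * L) * (1 / 2) ^ (r * L)) := by ring
      _ = _ := by rw [h3, mul_one]

end BlockProb

lemma liminf_eq_zero_of_tendsto_comp {u : ℕ → ℝ} (h0 : ∀ n, 0 ≤ u n) (h1 : ∀ n, u n ≤ 1)
    {v : ℕ → ℕ} (hv : Tendsto v atTop atTop) (h : Tendsto (fun k => u (v k)) atTop (𝓝 0)) :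
    liminf u atTop = 0 := by
  have hbdd : IsBoundedUnder (· ≥ ·) atTop u := isBoundedUnder_of ⟨0, h0⟩
  have hcobdd : IsCoboundedUnder (· ≥ ·) atTop u :=
    (isBoundedUnder_of ⟨1, h1⟩ : IsBoundedUnder (· ≤ ·) atTop u).isCoboundedUnder_ge
  refine le_antisymm (le_of_forall_pos_le_add fun η hη => ?_)
    (le_liminf_of_le hcobdd (.of_forall h0))
  refine liminf_le_of_frequently_le ?_ hbdd
  have hev : ∀ᶠ k in atTop, u (v k) ≤ 0 + η := h.eventually_le_const (by linarith)
  exact hv.frequently hev.frequently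

lemma limsup_eq_one_of_tendsto_comp {u : ℕ → ℝ} (h0 : ∀ n, 0 ≤ u n) (h1 : ∀ n, u n ≤ 1)
    {v : ℕ → ℕ} (hv : Tendsto v atTop atTop)
    (h : ∀ η : ℝ, 0 < η → ∀ᶠ k in atTop, 1 - η ≤ u (v k)) :
    limsup u atTop = 1 := by
  have hbdd : IsBoundedUnder (· ≤ ·) atTop u := isBoundedUnder_of ⟨1, h1⟩
  have hcobdd : IsCoboundedUnder (· ≤ ·) atTop u :=
    (isBoundedUnder_of ⟨0, h0⟩ : IsBoundedUnder (· ≥ ·) atTop u).isCoboundedUnder_le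
  refine le_antisymm (limsup_le_of_le hcobdd (.of_forall h1))
    (le_of_forall_pos_le_add fun η hη => ?_)
  have := le_limsup_of_frequently_le (hv.frequently (h η hη).frequently) hbdd
  linarith

end DistanceRandomGraph

open DistanceRandomGraph in
theorem theorem1 :
    (∀ p : ℕ → ℝ, (∀ i : ℕ, 1 ≤ i → 0 ≤ p i ∧ p i < 1) →
      Tendsto (fun n : ℕ => Real.log (∏ i ∈ Finset.Icc 1 n, (1 - p i)) / Real.log (n : ℝ))
        atTop (𝓝 0) →
      ∀ ψ : FirstOrder.Language.graph.Sentence,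
        Tendsto (fun n : ℕ => DistanceRandomGraph.sentenceProb p n ψ) atTop (𝓝 0) ∨
        Tendsto (fun n : ℕ => DistanceRandomGraph.sentenceProb p n ψ) atTop (𝓝 1)) ∧
    (∀ ε : ℝ, 0 < ε →
      ∃ (p : ℕ → ℝ) (ψ : FirstOrder.Language.graph.Sentence),
        (∀ i : ℕ, 1 ≤ i → 0 ≤ p i ∧ p i < 1) ∧
        (∀ n : ℕ, 2 ≤ n →
          -Real.log (∏ i ∈ Finset.Icc 1 n, (1 - p i)) / Real.log (n : ℝ) < ε) ∧
        liminf (fun n : ℕ => DistanceRandomGraph.sentenceProb p n ψ) atTop = 0 ∧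
        limsup (fun n : ℕ => DistanceRandomGraph.sentenceProb p n ψ) atTop = 1) := by
  refine ⟨fun p hp hlim ψ => tendsto_sentenceProb hp ?_ ψ, fun ε hε => ?_⟩
  · refine (neg_zero (G := ℝ) ▸ hlim.neg).congr fun n => ?_
    rw [log_prod_eq hp, neg_div, neg_neg]
  · obtain ⟨r, hr⟩ := exists_nat_ge (max 3 (4 / ε))
    have hr3 : 3 ≤ r := by exact_mod_cast (le_max_left _ _).trans hr
    have hrε : 4 ≤ r * ε := (div_le_iff₀ hε).1 ((le_max_right _ _).trans hr)
    have hlog2 : 0 < Real.log 2 := Real.log_pos one_lt_two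
    -- the probability at distance `1` is chosen to have load `ε / 4 * log 2`
    set a : ℝ := 1 - Real.exp (-(ε / 4 * Real.log 2)) with ha_def
    have ha1 : a < 1 := by linarith [Real.exp_pos (-(ε / 4 * Real.log 2))]
    have ha : 0 < a := by
      have : Real.exp (-(ε / 4 * Real.log 2)) < 1 := Real.exp_lt_one_iff.2 (by
        have : 0 < ε / 4 * Real.log 2 := by positivity
        linarith)
      linarith
    have haε : -Real.log (1 - a) < ε / 2 * Real.log 2 := by
      rw [ha_def, sub_sub_cancel, Real.log_exp]
      nlinarith
    have hp := blockProb_bounds (r := r) ha ha1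
    refine ⟨blockProb a r, closedPathSentence r, hp, fun n hn => ?_, ?_, ?_⟩
    · rw [log_prod_eq hp, neg_neg,
        div_lt_iff₀ (Real.log_pos (by exact_mod_cast (by omega : 1 < n)))]
      exact totalLoad_blockProb_lt (by omega) ha ha1 hrε haε hn
    · refine liminf_eq_zero_of_tendsto_comp (fun n => eventProb_nonneg hp _)
        (fun n => eventProb_le_one hp _) ?_ (tendsto_sentenceProb_blockProb hr3 ha ha1)
      exact tendsto_atTop_mono (fun k => by omega)
        (blockStart_strictMono (by omega : 1 ≤ r)).tendsto_atTop
    · exact limsup_eq_one_of_tendsto_comp (fun n => eventProb_nonneg hp _)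
        (fun n => eventProb_le_one hp _)
        ((pow_right_strictMono₀ (one_lt_two (α := ℕ))).comp blockLength_strictMono).tendsto_atTop
        fun η hη => eventually_sentenceProb_blockProb_ge (by omega) ha ha1 hη
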